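/- Let $n\ge 2$. Let $\mathbb R^{n,1}$ be $\mathbb R^{n+1}$ with the Lorentz form of signature $(n,1)$, let $\mathbb H^n$ be the upper sheet of the hyperboloid $\langle x,x\rangle=-1$, and let $\Gamma$ be a discrete torsion-free subgroup of $O^+(n,1)=\mathrm{Isom}(\mathbb H^n)$, so that $M=\Gamma\backslash\mathbb H^n$ is a complete hyperbolic $n$-manifold. Let $\Delta\subset M$ be a branched totally geodesic hypersurface with branching locus $\mathscr B$; that is, $\mathscr B\subseteq\Delta$ are closed subsets of $M$ with preimages $\tilde{\mathscr B}\subseteq\tilde\Delta$ in $\mathbb H^n$ such that * every point of $\tilde\Delta\setminus\tilde{\mathscr B}$ has a neighbourhood in which $\tilde\Delta$ coincides with a totally geodesic hyperplane through that point; * every point of $\tilde{\mathscr B}$ has a neighbourhood in which $\tilde{\mathscr B}$ coincides with a totally geodesic copy of $\mathbb H^{n-2}$ through that point and $\tilde\Delta$ coincides with the union of finitely many (at least one) half-hyperplanes bounded by that $\mathbb H^{n-2}$. Let $c_{n-1}$ be the number of connected components of $\Delta\setminus\mathscr B$ and $c_{n-2}$ the number of connected components of $\mathscr B$ (both in $\{0,1,2,\dots,\infty\}$).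 Suppose that for every connected component $\delta$ of $\mathbb H^n\setminus\tilde\Delta$ the setwise stabilizer $\mathrm{Fix}_\Gamma(\delta)=\{\gamma\in\Gamma:\gamma\delta=\delta\}$ is Zariski dense, in the sense that every real polynomial in the matrix entries that vanishes on $\mathrm{Fix}_\Gamma(\delta)$ vanishes on $SO^+(n,1)$. Then $$\dim_{\mathbb R}H^1(\Gamma,\mathbb R^{n,1})\ \ge\ c_{n-1}-2c_{n-2},$$ where $\Gamma$ acts linearly on $\mathbb R^{n,1}$ in the tautological way; when the numbers may be infinite this is read as $c_{n-1}\le \dim_{\mathbb R} H^1(\Gamma,\mathbb R^{n,1})+2c_{n-2}$ in $\{0,1,2,\dots,\infty\}$. -/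

import Mathlib

open scoped MatrixGroups

noncomputable section

namespace BranchedBending

/-! ### Hyperbolic space and its isometry group (hyperboloid model) -/

/-- The vector space `ℝ^{n,1}`; the coordinate `0` is the time-like one. -/
abbrev Mink (n : ℕ) : Type := Fin (n + 1) → ℝ

/-- The Lorentz form `-x₀y₀ + x₁y₁ + ⋯ + xₙyₙ` of signature `(n, 1)`. -/
def lorentz {n : ℕ} (x y : Mink n) : ℝ :=
  -(x 0 * y 0) + ∑ i : Fin n, x i.succ * y i.succ

/-- The upper sheet of the hyperboloid `⟨x, x⟩ = -1`. -/
def hyperboloid (n : ℕ) : Set (Mink n) :=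
  {x | lorentz x x = -1 ∧ 0 < x 0}

/-- Hyperbolic `n`-space, with the topology induced from `ℝ^{n,1}`
(which is also that of the hyperbolic metric). -/
abbrev Hyp (n : ℕ) : Type := hyperboloid n

/-- `O⁺(n,1) = Isom(ℍⁿ)`: the linear automorphisms of `ℝ^{n,1}` that preserve the Lorentz form and
the upper sheet of the hyperboloid. -/
def OPlus (n : ℕ) : Subgroup (GL (Fin (n + 1)) ℝ) where
  carrier := {g | (∀ x y : Mink n, lorentz (g.val.mulVec x) (g.val.mulVec y) = lorentz x y) ∧
    ∀ x : Mink n, g.val.mulVec x ∈ hyperboloid n ↔ x ∈ hyperboloid n}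
  one_mem' := by simp
  mul_mem' := by
    rintro a b ⟨ha, ha'⟩ ⟨hb, hb'⟩
    refine ⟨fun x y => ?_, fun x => ?_⟩
    · rw [Units.val_mul, ← Matrix.mulVec_mulVec, ← Matrix.mulVec_mulVec, ha, hb]
    · rw [Units.val_mul, ← Matrix.mulVec_mulVec, ha', hb']
  inv_mem' := by
    rintro a ⟨ha, ha'⟩
    have key : ∀ x : Mink n, a.val.mulVec ((a⁻¹).val.mulVec x) = x := fun x => by
      rw [Matrix.mulVec_mulVec, ← Units.val_mul, mul_inv_cancel]; simp
    refine ⟨fun x y => ?_, fun x => ?_⟩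
    · rw [← ha, key, key]
    · rw [← ha', key]

/-- `SO⁺(n,1)`, the orientation-preserving isometries of `ℍⁿ`, as a subset of `O⁺(n,1)`. -/
def SOPlus (n : ℕ) : Set (OPlus n) := {g | g.val.val.det = 1}

/-- The action of `O⁺(n,1)` on `ℍⁿ`. -/
instance instMulActionHyp (n : ℕ) : MulAction (OPlus n) (Hyp n) where
  smul g x := ⟨g.val.val.mulVec x.val, (g.property.2 x.val).2 x.property⟩
  one_smul x := Subtype.ext (Matrix.one_mulVec x.val)
  mul_smul a b x := Subtype.ext (Matrix.mulVec_mulVec x.val a.val.val b.val.val).symm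

/-- The tautological representation of a subgroup `Γ` of `O⁺(n,1)` on `ℝ^{n,1}`. -/
def stdRep {n : ℕ} (Γ : Subgroup (OPlus n)) : Representation ℝ Γ (Mink n) :=
  ((Matrix.toLinAlgEquiv' : Matrix (Fin (n + 1)) (Fin (n + 1)) ℝ ≃ₐ[ℝ] (Mink n →ₗ[ℝ] Mink n)) :
      Matrix (Fin (n + 1)) (Fin (n + 1)) ℝ →* (Mink n →ₗ[ℝ] Mink n)).comp
    ((Units.coeHom (Matrix (Fin (n + 1)) (Fin (n + 1)) ℝ)).comp
      ((OPlus n).subtype.comp Γ.subtype))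

/-- The first group cohomology `H¹(Γ, ℝ^{n,1})`. -/
abbrev H1 {n : ℕ} (Γ : Subgroup (OPlus n)) : Type :=
  groupCohomology.H1 (Rep.of (stdRep Γ))

/-- The Zariski closure of `S` contains `SO⁺(n,1)`: every real polynomial in the matrix entries
that vanishes on `S` vanishes on `SO⁺(n,1)`. For `S ⊆ SO⁺(n,1)` this is Zariski density of `S` in
`SO⁺(n,1)`. -/
def IsZariskiDense {n : ℕ} (S : Set (OPlus n)) : Prop :=
  ∀ p : MvPolynomial (Fin (n + 1) × Fin (n + 1)) ℝ,
    (∀ g ∈ S, MvPolynomial.eval (fun ij => g.val.val ij.1 ij.2) p = 0) →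
      ∀ g ∈ SOPlus n, MvPolynomial.eval (fun ij => g.val.val ij.1 ij.2) p = 0

/-! ### The quotient manifold and branched totally geodesic hypersurfaces -/

/-- The quotient `M = Γ \ ℍⁿ`, with the quotient topology. -/
abbrev Mfd {n : ℕ} (Γ : Subgroup (OPlus n)) : Type :=
  MulAction.orbitRel.Quotient Γ (Hyp n)

/-- The preimage in `ℍⁿ` of a subset of `M = Γ \ ℍⁿ`. -/
def upstairs {n : ℕ} (Γ : Subgroup (OPlus n)) (A : Set (Mfd Γ)) : Set (Hyp n) :=
  {x | (Quotient.mk _ x : Mfd Γ) ∈ A}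

/-- The totally geodesic hyperplane of `ℍⁿ` orthogonal to `ν` (used for unit space-like `ν`). -/
def hyperplane {n : ℕ} (ν : Mink n) : Set (Hyp n) :=
  {x | lorentz x.val ν = 0}

/-- `e₁, e₂` are orthonormal space-like vectors; their common orthogonal complement then cuts
`ℍⁿ` in a totally geodesic copy of `ℍ^{n-2}`, and every such copy arises in this way. -/
def IsSpacelikePair {n : ℕ} (e₁ e₂ : Mink n) : Prop :=
  lorentz e₁ e₁ = 1 ∧ lorentz e₂ e₂ = 1 ∧ lorentz e₁ e₂ = 0

/-- The codimension-two totally geodesic subspace orthogonal to `e₁` and `e₂`. -/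
def axis {n : ℕ} (e₁ e₂ : Mink n) : Set (Hyp n) :=
  {x | lorentz x.val e₁ = 0 ∧ lorentz x.val e₂ = 0}

/-- The closed half-hyperplane bounded by `axis e₁ e₂` that leaves the axis in the direction
`cos θ • e₁ + sin θ • e₂`. -/
def page {n : ℕ} (e₁ e₂ : Mink n) (θ : Real.Angle) : Set (Hyp n) :=
  {x | lorentz x.val ((-θ.sin) • e₁ + θ.cos • e₂) = 0 ∧
    0 ≤ lorentz x.val (θ.cos • e₁ + θ.sin • e₂)}

/-- `Δ` is a branched totally geodesic hypersurface of `M = Γ \ ℍⁿ` with branching locus `B`: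
both are closed, `B ⊆ Δ`, near each point off `B` the hypersurface is a totally geodesic
hyperplane, and near each point of `B` it consists of finitely many (at least one)
half-hyperplanes issuing from a common codimension-two totally geodesic subspace, which is `B`. The
local conditions are expressed in the universal cover. -/
structure IsBranchedHypersurface {n : ℕ} (Γ : Subgroup (OPlus n)) (Δ B : Set (Mfd Γ)) :
    Prop where
  isClosed : IsClosed Δ
  isClosed_locus : IsClosed B
  locus_subset : B ⊆ Δ
  flat : ∀ p ∈ upstairs Γ Δ \ upstairs Γ B, ∃ ν : Mink n, lorentz ν ν = 1 ∧ p ∈ hyperplane ν ∧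
    ∃ U : Set (Hyp n), IsOpen U ∧ p ∈ U ∧ upstairs Γ Δ ∩ U = hyperplane ν ∩ U
  branch : ∀ p ∈ upstairs Γ B, ∃ e₁ e₂ : Mink n, IsSpacelikePair e₁ e₂ ∧ p ∈ axis e₁ e₂ ∧
    ∃ Θ : Finset Real.Angle, Θ.Nonempty ∧
      ∃ U : Set (Hyp n), IsOpen U ∧ p ∈ U ∧ upstairs Γ B ∩ U = axis e₁ e₂ ∩ U ∧
        upstairs Γ Δ ∩ U = (⋃ θ ∈ Θ, page e₁ e₂ θ) ∩ U

/-- `Fix_Γ(δ)`: the elements of `Γ` that map `δ ⊆ ℍⁿ` onto itself. -/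
def setwiseFix {n : ℕ} (Γ : Subgroup (OPlus n)) (δ : Set (Hyp n)) : Set (OPlus n) :=
  {γ | γ ∈ Γ ∧ (fun x : Hyp n => γ • x) '' δ = δ}

/-- The cells: the connected components of `ℍⁿ` minus the lifted complex. -/
def cells {n : ℕ} (Γ : Subgroup (OPlus n)) (Δ : Set (Mfd Γ)) : Set (Set (Hyp n)) :=
  {δ | ∃ x ∈ (upstairs Γ Δ)ᶜ, δ = connectedComponentIn (upstairs Γ Δ)ᶜ x}

/-- The number of connected components of a subset `A` of `M` (in its subspace topology), with value
`⊤` if there are infinitely many. -/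
def numComponents {n : ℕ} {Γ : Subgroup (OPlus n)} (A : Set (Mfd Γ)) : ℕ∞ :=
  ENat.card (ConnectedComponents A)

end BranchedBending

end

/-! The proof bends with weights. Give every component of `Δ \ B` a real weight and look for a
locally constant `ℝ^{n,1}`-valued function `f` off the lifted hypersurface that jumps by `2wν` when
a smooth piece of weight `w` is crossed in the direction of its unit normal `ν`. Replacing `ν` by
`-ν` reverses both the crossing and the jump, so no transverse orientation is needed.

Near a branching stratum such an `f` exists as soon as the weighted sum of the page normals vanishes
(`IsBook.exists_hasJump`). The normals lie in a plane, so this amounts to two linear conditions.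
Local solvability is invariant under `Γ` and locally constant along the branching locus, so two
conditions per component of `B` are enough (`exists_conditions`). Two solutions on a convex set
differ by a constant, because the branching locus has codimension two and does not separate. Hence
local solutions continue along segments to a global one (`BranchedCone.exists_solvesOn`). Everything
takes place in the future cone over `ℍⁿ`, where geodesic pieces become linear and convexity is
available.

A translate of a solution `f` by `γ` solves the same jump problem, so it equals `f + c γ`, and `c`
is a cocycle. If `c` is the coboundary of `v`, then `f - v` is equivariant, and its value on a cell
is fixed by the stabilizer of that cell. Zariski density makes this value zero. So `f` is the
constant `v`, there are no jumps and all weights vanish (`IsDeviation.weight_eq_zero`). The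
admissible weights therefore inject into `H¹`, and counting dimensions gives the bound. -/

open scoped MatrixGroups

noncomputable section

namespace BranchedBending

open Filter Topology

/-! ### The Lorentz form -/

section Lorentz

variable {n : ℕ}

theorem lorentz_comm (x y : Mink n) : lorentz x y = lorentz y x := by
  simp [lorentz, mul_comm]

theorem lorentz_add_left (x y z : Mink n) : lorentz (x + y) z = lorentz x z + lorentz y z := by
  simp only [lorentz, Pi.add_apply, add_mul, Finset.sum_add_distrib]; ring

theorem lorentz_smul_left (a : ℝ) (x z : Mink n) : lorentz (a • x) z = a * lorentz x z := by
  simp only [lorentz, Pi.smul_apply, smul_eq_mul, mul_assoc, ← Finset.mul_sum]; ring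

theorem lorentz_add_right (x y z : Mink n) : lorentz x (y + z) = lorentz x y + lorentz x z := by
  simp only [lorentz_comm x, lorentz_add_left]

theorem lorentz_smul_right (a : ℝ) (x z : Mink n) : lorentz x (a • z) = a * lorentz x z := by
  simp only [lorentz_comm x, lorentz_smul_left]

theorem lorentz_neg_left (x z : Mink n) : lorentz (-x) z = -lorentz x z := by
  rw [← neg_one_smul ℝ x, lorentz_smul_left, neg_one_mul]

theorem lorentz_neg_right (x z : Mink n) : lorentz x (-z) = -lorentz x z := by
  simp only [lorentz_comm x, lorentz_neg_left]

theorem lorentz_sub_left (x y z : Mink n) : lorentz (x - y) z = lorentz x z - lorentz y z := by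
  rw [sub_eq_add_neg, lorentz_add_left, lorentz_neg_left, sub_eq_add_neg]

theorem lorentz_sub_right (x y z : Mink n) : lorentz x (y - z) = lorentz x y - lorentz x z := by
  simp only [lorentz_comm x, lorentz_sub_left]

@[fun_prop]
theorem continuous_lorentz {X : Type*} [TopologicalSpace X] {f g : X → Mink n}
    (hf : Continuous f) (hg : Continuous g) : Continuous fun x => lorentz (f x) (g x) := by
  unfold lorentz; fun_prop

theorem eq_zero_of_lorentz_eq_zero {x : Mink n} (h : ∀ y, lorentz y x = 0) : x = 0 := by
  funext i
  refine Fin.cases ?_ (fun i => ?_) i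
  · have := h (Pi.single 0 1)
    simpa [lorentz] using this
  · have := h (Pi.single i.succ 1)
    simpa [lorentz, Pi.single_apply, Fin.succ_inj, (Fin.succ_ne_zero _).symm] using this

theorem convex_lorentz_eq_zero (ν : Mink n) : Convex ℝ {x : Mink n | lorentz x ν = 0} := by
  intro x hx y hy a b _ _ _
  simp only [Set.mem_ofPred_eq] at *
  rw [lorentz_add_left, lorentz_smul_left, lorentz_smul_left, hx, hy]; simp

theorem convex_lorentz_pos (ν : Mink n) : Convex ℝ {x : Mink n | 0 < lorentz x ν} := by
  have : IsLinearMap ℝ fun x : Mink n => lorentz x ν :=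
    ⟨fun x y => lorentz_add_left x y ν, fun a x => lorentz_smul_left a x ν⟩
  exact convex_halfSpace_gt this 0

end Lorentz

/-- A condition that holds near `p` holds at some `p + t • v` with `t > 0`. -/
theorem exists_pos_add_smul {E : Type*} [NormedAddCommGroup E] [NormedSpace ℝ E] {p : E}
    {P : E → Prop} (h : ∀ᶠ x in 𝓝 p, P x) (v : E) : ∃ t : ℝ, 0 < t ∧ P (p + t • v) := by
  have hc : Tendsto (fun t : ℝ => p + t • v) (𝓝[>] 0) (𝓝 p) := by
    have : Continuous fun t : ℝ => p + t • v := by fun_prop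
    simpa using (this.tendsto 0).mono_left nhdsWithin_le_nhds
  obtain ⟨t, ht, ht'⟩ := ((hc.eventually h).and self_mem_nhdsWithin).exists
  exact ⟨t, ht', ht⟩

/-! ### Normals to a hypersurface -/

section Normal

variable {n : ℕ} {D : Set (Mink n)} {p ν ν' : Mink n}

/-- `D` coincides near `p` with the hyperplane through `p` orthogonal to the unit vector `ν`. -/
structure IsUnitNormal (D : Set (Mink n)) (p ν : Mink n) : Prop where
  unit : lorentz ν ν = 1
  mem : lorentz p ν = 0
  eventually : ∀ᶠ x in 𝓝 p, (x ∈ D ↔ lorentz x ν = 0)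

/-- `ν` is a unit normal to `D` at `p ∈ D`, or zero if `p ∉ D`. -/
def IsNormal (D : Set (Mink n)) (p ν : Mink n) : Prop :=
  (p ∉ D ∧ ν = 0) ∨ IsUnitNormal D p ν

theorem IsUnitNormal.mem_set (h : IsUnitNormal D p ν) : p ∈ D :=
  h.eventually.self_of_nhds.2 h.mem

/-- Short displacements from `p` inside one hyperplane stay in `D`, hence in the other hyperplane.
The two linear hyperplanes thus agree, and unit length leaves only the sign. -/
theorem IsUnitNormal.eq_or_eq_neg (h : IsUnitNormal D p ν) (h' : IsUnitNormal D p ν') :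
    ν' = ν ∨ ν' = -ν := by
  have key : ∀ y, lorentz y ν = 0 → lorentz y ν' = 0 := by
    intro y hy
    obtain ⟨t, ht, h1, h2⟩ := exists_pos_add_smul (h.eventually.and h'.eventually) y
    have := h2.1 (h1.2 (by rw [lorentz_add_left, lorentz_smul_left, h.mem, hy]; simp))
    rw [lorentz_add_left, lorentz_smul_left, h'.mem, zero_add] at this
    exact (mul_eq_zero.1 this).resolve_left ht.ne'
  have hν : ν' - lorentz ν ν' • ν = 0 := by
    refine eq_zero_of_lorentz_eq_zero fun z => ?_
    have := key (z - lorentz z ν • ν) (by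
      rw [lorentz_sub_left, lorentz_smul_left, h.unit]; simp)
    rw [lorentz_sub_left, lorentz_smul_left] at this
    rw [lorentz_sub_right, lorentz_smul_right, mul_comm]; exact this
  rw [sub_eq_zero] at hν
  have h1 := h'.unit
  rw [hν, lorentz_smul_left, lorentz_smul_right, h.unit, mul_one, mul_self_eq_one_iff] at h1
  rcases h1 with h1 | h1 <;> rw [h1] at hν <;> simp [hν]

theorem IsNormal.eq_or_eq_neg (h : IsNormal D p ν) (h' : IsNormal D p ν') :
    ν' = ν ∨ ν' = -ν := by
  rcases h with ⟨h, rfl⟩ | h <;> rcases h' with ⟨h', rfl⟩ | h'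
  · simp
  · exact absurd h'.mem_set h
  · exact absurd h.mem_set h'
  · exact h.eq_or_eq_neg h'

theorem sign_smul_neg (x ν : Mink n) :
    Real.sign (lorentz x (-ν)) • (-ν) = Real.sign (lorentz x ν) • ν := by
  rw [lorentz_neg_right, Real.sign_neg, smul_neg, neg_smul, neg_neg]

theorem IsNormal.sign_smul_eq (h : IsNormal D p ν) (h' : IsNormal D p ν') (x : Mink n) :
    Real.sign (lorentz x ν') • ν' = Real.sign (lorentz x ν) • ν := by
  rcases h.eq_or_eq_neg h' with rfl | rfl
  · rfl
  · exact sign_smul_neg x ν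

/-- Off `D`, the function `f` jumps by `2 w ν` across `D` near `p`, in the direction of the unit
normal `ν`; it is constant near `p` if `p ∉ D`. -/
def HasJump (D : Set (Mink n)) (w : Mink n → ℝ) (f : Mink n → Mink n) (p : Mink n) : Prop :=
  ∀ ν, IsNormal D p ν →
    ∃ c, ∀ᶠ x in 𝓝[Dᶜ] p, f x = c + w p • Real.sign (lorentz x ν) • ν

variable {w w' : Mink n → ℝ} {f g : Mink n → Mink n}

/-- The product of the sign and the normal is unchanged under `ν ↦ -ν`, so one normal decides for
all. -/
theorem HasJump.of_isNormal (h : IsNormal D p ν) (c : Mink n)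
    (hc : ∀ᶠ x in 𝓝[Dᶜ] p, f x = c + w p • Real.sign (lorentz x ν) • ν) : HasJump D w f p := by
  intro ν' h'
  refine ⟨c, hc.mono fun x hx => ?_⟩
  rw [hx, h.sign_smul_eq h']

theorem HasJump.congr (h : HasJump D w f p) (hfg : ∀ᶠ x in 𝓝[Dᶜ] p, g x = f x) :
    HasJump D w g p := fun ν hν => by
  obtain ⟨c, hc⟩ := h ν hν
  exact ⟨c, by filter_upwards [hc, hfg] with x h1 h2; rw [h2, h1]⟩

theorem HasJump.add_const (h : HasJump D w f p) (v : Mink n) :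
    HasJump D w (fun x => f x + v) p := fun ν hν => by
  obtain ⟨c, hc⟩ := h ν hν
  exact ⟨c + v, by filter_upwards [hc] with x h1; rw [h1]; abel⟩

theorem HasJump.add (hf : HasJump D w f p) (hg : HasJump D w' g p) :
    HasJump D (w + w') (f + g) p := fun ν hν => by
  obtain ⟨c, hc⟩ := hf ν hν
  obtain ⟨d, hd⟩ := hg ν hν
  refine ⟨c + d, ?_⟩
  filter_upwards [hc, hd] with x h1 h2
  rw [Pi.add_apply, h1, h2, Pi.add_apply, add_smul]; abel

theorem HasJump.const_smul (hf : HasJump D w f p) (a : ℝ) :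
    HasJump D (a • w) (a • f) p := fun ν hν => by
  obtain ⟨c, hc⟩ := hf ν hν
  refine ⟨a • c, ?_⟩
  filter_upwards [hc] with x h1
  rw [Pi.smul_apply, h1, smul_add, Pi.smul_apply, smul_eq_mul, mul_smul]

theorem HasJump.zero : HasJump D 0 0 p := fun ν _ => ⟨0, by simp⟩

theorem HasJump.sum {ι : Type*} (s : Finset ι) {w : ι → Mink n → ℝ} {f : ι → Mink n → Mink n}
    (h : ∀ i ∈ s, HasJump D (w i) (f i) p) : HasJump D (∑ i ∈ s, w i) (∑ i ∈ s, f i) p := by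
  classical
  induction s using Finset.induction_on with
  | empty => simpa using HasJump.zero
  | insert i s hi ih =>
    rw [Finset.sum_insert hi, Finset.sum_insert hi]
    exact (h i (Finset.mem_insert_self i s)).add
      (ih fun j hj => h j (Finset.mem_insert_of_mem hj))

/-- Functions with the same jumps differ by a constant near `p`. -/
theorem HasJump.exists_sub_const (hf : HasJump D w f p) (hg : HasJump D w g p)
    (hν : IsNormal D p ν) : ∃ c, ∀ᶠ x in 𝓝[Dᶜ] p, f x - g x = c := by
  obtain ⟨c, hc⟩ := hf ν hν
  obtain ⟨d, hd⟩ := hg ν hν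
  refine ⟨c - d, ?_⟩
  filter_upwards [hc, hd] with x h1 h2
  rw [h1, h2]; abel

end Normal

/-! ### Functions on the plane that jump along rays -/

/-- The sum of the values of `a` at the rays met when turning from the negative real axis to `z`. -/
def raySum {E : Type*} [AddCommGroup E] (Θ : Finset Real.Angle) (a : Real.Angle → E) (z : ℂ) : E :=
  ∑ θ ∈ Θ, if θ.toReal < z.arg then a θ else 0

theorem angle_arg_toReal (z : ℂ) : (z.arg : Real.Angle).toReal = z.arg :=
  Real.Angle.toReal_coe_eq_self_iff.2 ⟨Complex.neg_pi_lt_arg z, Complex.arg_le_pi z⟩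

theorem neg_sin_mul_re_add_cos_mul_im (θ : Real.Angle) (z : ℂ) :
    -θ.sin * z.re + θ.cos * z.im = ‖z‖ * ((z.arg : Real.Angle) - θ).sin := by
  rw [sub_eq_add_neg, Real.Angle.sin_add, Real.Angle.cos_neg, Real.Angle.sin_neg,
    Real.Angle.sin_coe, Real.Angle.cos_coe, ← Complex.norm_mul_cos_arg z,
    ← Complex.norm_mul_sin_arg z]
  simp only [Complex.norm_mul_cos_arg, Complex.norm_mul_sin_arg]
  have h1 := Complex.norm_mul_cos_arg z
  have h2 := Complex.norm_mul_sin_arg z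
  linear_combination -θ.cos * h2 + θ.sin * h1

theorem cos_mul_re_add_sin_mul_im (θ : Real.Angle) (z : ℂ) :
    θ.cos * z.re + θ.sin * z.im = ‖z‖ * ((z.arg : Real.Angle) - θ).cos := by
  rw [sub_eq_add_neg, Real.Angle.cos_add, Real.Angle.cos_neg, Real.Angle.sin_neg,
    Real.Angle.sin_coe, Real.Angle.cos_coe]
  have h1 := Complex.norm_mul_cos_arg z
  have h2 := Complex.norm_mul_sin_arg z
  linear_combination -θ.cos * h1 - θ.sin * h2

theorem eq_zero_of_sin_eq_zero_of_cos_nonneg {θ : Real.Angle} (h : θ.sin = 0) (h' : 0 ≤ θ.cos) :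
    θ = 0 := by
  rcases Real.Angle.sin_eq_zero_iff.1 h with h | h
  · exact h
  · rw [h, Real.Angle.cos_coe_pi] at h'; linarith

/-- The linear form equals `‖z‖ sin (arg z - arg z₀)`. Away from the cut the difference of arguments
stays in `(-π, π)`, where the sine has the sign of its argument. -/
theorem eventually_arg_lt_iff {z₀ : ℂ} (hs : z₀ ∈ Complex.slitPlane) :
    ∀ᶠ z in 𝓝 z₀, (z₀.arg < z.arg ↔
      0 < -(z₀.arg : Real.Angle).sin * z.re + (z₀.arg : Real.Angle).cos * z.im) := by
  have hc := Complex.continuousAt_arg hs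
  have h1 : ∀ᶠ z in 𝓝 z₀, z.arg < z₀.arg + Real.pi :=
    hc.eventually_lt continuousAt_const (by linarith [Real.pi_pos])
  have h2 : ∀ᶠ z in 𝓝 z₀, z₀.arg - Real.pi < z.arg :=
    continuousAt_const.eventually_lt hc (by linarith [Real.pi_pos])
  have h3 : ∀ᶠ z in 𝓝 z₀, z ≠ 0 := isOpen_ne.mem_nhds (Complex.slitPlane_ne_zero hs)
  filter_upwards [h1, h2, h3] with z h1 h2 h3
  rw [neg_sin_mul_re_add_cos_mul_im, ← Real.Angle.coe_sub, Real.Angle.sin_coe,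
    mul_pos_iff_of_pos_left (norm_pos_iff.2 h3)]
  constructor
  · intro h
    exact Real.sin_pos_of_pos_of_lt_pi (by linarith) (by linarith)
  · intro h
    by_contra hlt
    have := Real.sin_nonpos_of_nonpos_of_neg_pi_le (x := z.arg - z₀.arg)
      (by linarith [not_lt.1 hlt]) (by linarith)
    linarith

-- Off the negative real axis only the ray through `z₀` can change its contribution. Across that
-- axis `arg` drops from `π` to `-π` and all terms are lost at once; the vanishing of the total sum
-- makes this invisible, up to the value carried by the axis itself.
open Classical in
theorem raySum_near {E : Type*} [AddCommGroup E] {Θ : Finset Real.Angle} {a : Real.Angle → E}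
    (hsum : ∑ θ ∈ Θ, a θ = 0) {z₀ : ℂ} (hz : z₀ ≠ 0) :
    ∃ c, ∀ᶠ z in 𝓝 z₀, raySum Θ a z = c +
      if (z₀.arg : Real.Angle) ∈ Θ ∧
        0 < -(z₀.arg : Real.Angle).sin * z.re + (z₀.arg : Real.Angle).cos * z.im
      then a z₀.arg else 0 := by
  set α := (z₀.arg : Real.Angle) with hα
  have hα' : α.toReal = z₀.arg := angle_arg_toReal z₀
  by_cases hs : z₀ ∈ Complex.slitPlane
  · have hc := Complex.continuousAt_arg hs
    have hterm : ∀ θ ∈ Θ, ∀ᶠ z in 𝓝 z₀, (if θ.toReal < z.arg then a θ else 0) =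
        (if θ.toReal < z₀.arg then a θ else 0) +
          if θ = α then (if 0 < -α.sin * z.re + α.cos * z.im then a α else 0) else 0 := by
      intro θ _
      rcases lt_trichotomy θ.toReal z₀.arg with h | h | h
      · have hne : θ ≠ α := by rintro rfl; exact h.ne hα'
        filter_upwards [continuousAt_const.eventually_lt hc h] with z hz
        simp [hz, h, hne]
      · have he : θ = α := by rw [← Real.Angle.toReal_inj, h, hα']
        filter_upwards [eventually_arg_lt_iff hs] with z hz
        rw [← hα] at hz
        simp only [he, if_true, hα', lt_irrefl, if_false, zero_add, hz]
      · have hne : θ ≠ α := by rintro rfl; exact h.ne' hα'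
        filter_upwards [hc.eventually_lt continuousAt_const h] with z hz
        simp [hz.not_gt, h.not_gt, hne]
    refine ⟨∑ θ ∈ Θ, if θ.toReal < z₀.arg then a θ else 0, ?_⟩
    filter_upwards [(Filter.eventually_all_finset Θ).2 hterm] with z hz
    rw [raySum, Finset.sum_congr rfl hz, Finset.sum_add_distrib, Finset.sum_ite_eq', ite_and]
  · have hpi : z₀.arg = Real.pi := by
      rw [Complex.mem_slitPlane_iff_arg] at hs
      by_contra h
      exact hs ⟨h, hz⟩
    obtain ⟨hre, him⟩ := Complex.arg_eq_pi_iff.1 hpi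
    have hαpi : α = Real.pi := by rw [hα, hpi]
    have hterm : ∀ θ ∈ Θ, ∀ᶠ z in 𝓝 z₀, (if θ.toReal < z.arg then a θ else 0) =
        if 0 ≤ z.im then (a θ - if θ = α then a α else 0) else 0 := by
      intro θ _
      have hlow : ∀ᶠ z in 𝓝 z₀, z.im < 0 → z.arg < θ.toReal := by
        have := Complex.tendsto_arg_nhdsWithin_im_neg_of_re_neg_of_im_zero hre him
        have := this.eventually_lt_const (Real.Angle.neg_pi_lt_toReal θ)
        exact eventually_nhdsWithin_iff.1 this
      have hup := Complex.tendsto_arg_nhdsWithin_im_nonneg_of_re_neg_of_im_zero hre him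
      by_cases hθ : θ = α
      · filter_upwards [hlow] with z hz
        have h0 : ¬ Real.pi < z.arg := not_lt.2 (Complex.arg_le_pi z)
        simp [hθ, h0, hα'.trans hpi]
      · have hlt : θ.toReal < Real.pi := lt_of_le_of_ne (Real.Angle.toReal_le_pi θ) fun h =>
          hθ (by rw [← Real.Angle.toReal_inj, h, hα', hpi])
        have hup' := eventually_nhdsWithin_iff.1 (hup.eventually_const_lt hlt)
        filter_upwards [hlow, hup'] with z h1 h2
        by_cases h : 0 ≤ z.im
        · simp [h, hθ, h2 h]
        · simp [h, (h1 (not_le.1 h)).not_gt]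
    -- A ray at angle `π` never satisfies the strict inequality. Above the axis the sum is therefore
    -- the total minus `a π`, that is `-a π`; below, it is zero.
    refine ⟨-if α ∈ Θ then a α else 0, ?_⟩
    filter_upwards [(Filter.eventually_all_finset Θ).2 hterm] with z hz
    rw [raySum, Finset.sum_congr rfl hz, hαpi, Real.Angle.sin_coe_pi, Real.Angle.cos_coe_pi,
      ite_and]
    by_cases h : 0 ≤ z.im
    · have h' : ¬ 0 < -0 * z.re + -1 * z.im := by linarith
      simp only [h, h', if_true, if_false, Finset.sum_sub_distrib, hsum, Finset.sum_ite_eq']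
      simp
    · have h' : 0 < -0 * z.re + -1 * z.im := by linarith
      simp only [h, h', if_true, if_false, Finset.sum_const_zero]
      simp

/-! ### Open books -/

section Book

variable {n : ℕ} {K : Type*}

/-- The unit normal of the page at angle `θ`, pointing in the direction of increasing angle. -/
def pageNormal (e₁ e₂ : Mink n) (θ : Real.Angle) : Mink n := (-θ.sin) • e₁ + θ.cos • e₂

/-- The direction of the page at angle `θ`. -/
def pageDir (e₁ e₂ : Mink n) (θ : Real.Angle) : Mink n := θ.cos • e₁ + θ.sin • e₂

/-- The linear half-hyperplane at angle `θ`. -/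
def linearPage (e₁ e₂ : Mink n) (θ : Real.Angle) : Set (Mink n) :=
  {x | lorentz x (pageNormal e₁ e₂ θ) = 0 ∧ 0 ≤ lorentz x (pageDir e₁ e₂ θ)}

/-- The coordinates of `x` in the normal plane spanned by `e₁` and `e₂`. -/
def planar (e₁ e₂ x : Mink n) : ℂ := ⟨lorentz x e₁, lorentz x e₂⟩

/-- Near `p`, the set `D` is the union of the pages at angles in `Θ`, with binding `L`, and `label`
takes the value `κ θ` on the page at angle `θ`. -/
structure IsBook (D L : Set (Mink n)) (label : Mink n → K) (p e₁ e₂ : Mink n)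
    (Θ : Finset Real.Angle) (κ : Real.Angle → K) : Prop where
  pair : IsSpacelikePair e₁ e₂
  mem₁ : lorentz p e₁ = 0
  mem₂ : lorentz p e₂ = 0
  locus : ∀ᶠ x in 𝓝 p, (x ∈ L ↔ lorentz x e₁ = 0 ∧ lorentz x e₂ = 0)
  pages : ∀ᶠ x in 𝓝 p, (x ∈ D ↔ ∃ θ ∈ Θ, x ∈ linearPage e₁ e₂ θ)
  label_eq : ∀ᶠ x in 𝓝 p, ∀ θ ∈ Θ, x ∈ linearPage e₁ e₂ θ → x ∉ L → label x = κ θ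

variable {D L : Set (Mink n)} {label : Mink n → K} {p e₁ e₂ : Mink n}
  {Θ : Finset Real.Angle} {κ : Real.Angle → K}

theorem planar_eq_zero_iff (x : Mink n) :
    planar e₁ e₂ x = 0 ↔ lorentz x e₁ = 0 ∧ lorentz x e₂ = 0 := by
  simp [planar, Complex.ext_iff]

theorem continuous_planar (e₁ e₂ : Mink n) : Continuous (planar e₁ e₂) := by
  have : planar e₁ e₂ =
      fun x => ((lorentz x e₁ : ℝ) : ℂ) + ((lorentz x e₂ : ℝ) : ℂ) * Complex.I := by
    funext x; apply Complex.ext <;> simp [planar]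
  rw [this]
  fun_prop

theorem lorentz_pageNormal (x : Mink n) (θ : Real.Angle) : lorentz x (pageNormal e₁ e₂ θ) =
    -θ.sin * (planar e₁ e₂ x).re + θ.cos * (planar e₁ e₂ x).im := by
  rw [pageNormal, lorentz_add_right, lorentz_smul_right, lorentz_smul_right, planar]

theorem lorentz_pageDir (x : Mink n) (θ : Real.Angle) : lorentz x (pageDir e₁ e₂ θ) =
    θ.cos * (planar e₁ e₂ x).re + θ.sin * (planar e₁ e₂ x).im := by
  rw [pageDir, lorentz_add_right, lorentz_smul_right, lorentz_smul_right, planar]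

theorem mem_linearPage_iff {x : Mink n} {θ : Real.Angle} (hx : planar e₁ e₂ x ≠ 0) :
    x ∈ linearPage e₁ e₂ θ ↔ ((planar e₁ e₂ x).arg : Real.Angle) = θ := by
  have hpos := norm_pos_iff.2 hx
  rw [linearPage, Set.mem_ofPred_eq, lorentz_pageNormal, lorentz_pageDir,
    neg_sin_mul_re_add_cos_mul_im, cos_mul_re_add_sin_mul_im, mul_eq_zero,
    or_iff_right hpos.ne', mul_nonneg_iff_of_pos_left hpos]
  constructor
  · rintro ⟨h1, h2⟩
    exact sub_eq_zero.1 (eq_zero_of_sin_eq_zero_of_cos_nonneg h1 h2)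
  · rintro rfl; simp

theorem lorentz_pageDir_pos {x : Mink n} {θ : Real.Angle} (hx : planar e₁ e₂ x ≠ 0)
    (h : x ∈ linearPage e₁ e₂ θ) : 0 < lorentz x (pageDir e₁ e₂ θ) := by
  rw [mem_linearPage_iff hx] at h
  rw [lorentz_pageDir, cos_mul_re_add_sin_mul_im, h]
  simpa using hx

theorem isClosed_linearPage (e₁ e₂ : Mink n) (θ : Real.Angle) :
    IsClosed (linearPage e₁ e₂ θ) := by
  refine (isClosed_eq (f := fun x => lorentz x (pageNormal e₁ e₂ θ)) (g := fun _ => (0 : ℝ))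
    (by fun_prop) continuous_const).inter
    (isClosed_le (f := fun _ => (0 : ℝ)) (g := fun x => lorentz x (pageDir e₁ e₂ θ))
      continuous_const (by fun_prop))

theorem lorentz_pageNormal_self (h : IsSpacelikePair e₁ e₂) (θ : Real.Angle) :
    lorentz (pageNormal e₁ e₂ θ) (pageNormal e₁ e₂ θ) = 1 := by
  obtain ⟨h1, h2, h3⟩ := h
  simp only [pageNormal, lorentz_add_left, lorentz_add_right, lorentz_smul_left,
    lorentz_smul_right, h1, h2, h3, lorentz_comm e₂ e₁]
  have := θ.cos_sq_add_sin_sq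
  linear_combination this

theorem planar_pageDir (h : IsSpacelikePair e₁ e₂) (θ : Real.Angle) :
    planar e₁ e₂ (pageDir e₁ e₂ θ) = ⟨θ.cos, θ.sin⟩ := by
  obtain ⟨h1, h2, h3⟩ := h
  simp [planar, pageDir, lorentz_add_left, lorentz_smul_left, h1, h2, h3, lorentz_comm e₂ e₁]

namespace IsBook

theorem eventually_planar_ne_zero (h : IsBook D L label p e₁ e₂ Θ κ) :
    ∀ᶠ x in 𝓝 p, x ∉ L → planar e₁ e₂ x ≠ 0 := by
  filter_upwards [h.locus] with x hx hL h0
  exact hL (hx.2 ((planar_eq_zero_iff x).1 h0))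

/-- Off the binding `q` lies on exactly one page. The other pages are closed and stay away from `q`,
and the inequality defining its own page is strict there, so only the linear equation remains. -/
theorem eventually_isUnitNormal (h : IsBook D L label p e₁ e₂ Θ κ) :
    ∀ᶠ q in 𝓝 p, q ∉ L → ∀ θ ∈ Θ, q ∈ linearPage e₁ e₂ θ →
      IsUnitNormal D q (pageNormal e₁ e₂ θ) := by
  filter_upwards [h.eventually_planar_ne_zero, eventually_eventually_nhds.2 h.pages]
    with q hq hpages hL θ hθ hqθ
  have hq := hq hL
  refine ⟨lorentz_pageNormal_self h.pair θ, hqθ.1, ?_⟩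
  have h1 : ∀ᶠ x in 𝓝 q, ∀ θ' ∈ Θ, θ' ≠ θ → x ∉ linearPage e₁ e₂ θ' := by
    refine (Filter.eventually_all_finset Θ).2 fun θ' _ => ?_
    by_cases hne : θ' = θ
    · exact Eventually.of_forall fun _ h' => absurd hne h'
    · filter_upwards [(isClosed_linearPage e₁ e₂ θ').isOpen_compl.mem_nhds
        (x := q) (fun hmem => hne (by
          rw [← (mem_linearPage_iff hq).1 hmem, (mem_linearPage_iff hq).1 hqθ]))] with x hx _
      exact hx
  have h2 : ∀ᶠ x in 𝓝 q, 0 < lorentz x (pageDir e₁ e₂ θ) :=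
    (continuous_const.tendsto q).eventually_lt
      ((show Continuous fun x => lorentz x (pageDir e₁ e₂ θ) by fun_prop).tendsto q)
      (lorentz_pageDir_pos hq hqθ)
  filter_upwards [hpages, h1, h2] with x hx h1 h2
  rw [hx]
  constructor
  · rintro ⟨θ', hθ', hx'⟩
    by_cases hne : θ' = θ
    · exact (hne ▸ hx').1
    · exact absurd hx' (h1 θ' hθ' hne)
  · exact fun h0 => ⟨θ, hθ, h0, h2.le⟩

/-- If the weighted sum of the page normals vanishes, then there is a function near `p` with the
prescribed jumps along the pages. -/
theorem exists_hasJump (h : IsBook D L label p e₁ e₂ Θ κ) (w : K → ℝ)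
    (hsum : ∑ θ ∈ Θ, w (κ θ) • pageNormal e₁ e₂ θ = 0) :
    ∃ f, ∀ᶠ q in 𝓝 p, q ∉ L → HasJump D (fun x => w (label x)) f q := by
  -- The factor `2` is there because `Real.sign` passes from `-1` to `1`. The constant in `HasJump`
  -- is then the mean of the two side values.
  refine ⟨fun x => raySum Θ (fun θ => (2 * w (κ θ)) • pageNormal e₁ e₂ θ) (planar e₁ e₂ x), ?_⟩
  have hsum' : ∑ θ ∈ Θ, (2 * w (κ θ)) • pageNormal e₁ e₂ θ = 0 := by
    simp only [mul_smul, ← Finset.smul_sum, hsum, smul_zero]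
  filter_upwards [h.eventually_isUnitNormal, h.eventually_planar_ne_zero, h.pages, h.label_eq]
    with q hnormal hq hpages hlabel hL
  have hq := hq hL
  obtain ⟨c, hc⟩ := raySum_near hsum' hq
  have hc := (continuous_planar e₁ e₂).continuousAt.eventually hc
  set α := ((planar e₁ e₂ q).arg : Real.Angle) with hα
  by_cases hmem : α ∈ Θ
  · have hqα : q ∈ linearPage e₁ e₂ α := (mem_linearPage_iff hq).2 rfl
    have hN := hnormal hL α hmem hqα
    refine HasJump.of_isNormal (Or.inr hN) (c + w (κ α) • pageNormal e₁ e₂ α) ?_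
    filter_upwards [nhdsWithin_le_nhds hc, nhdsWithin_le_nhds hN.eventually,
      self_mem_nhdsWithin] with x hx hxD hxD'
    have hne : lorentz x (pageNormal e₁ e₂ α) ≠ 0 := fun h0 => hxD' (hxD.2 h0)
    rw [hx, hlabel α hmem hqα hL, ← lorentz_pageNormal]
    rcases hne.lt_or_gt with h0 | h0
    · simp [h0.not_gt, Real.sign_of_neg h0]
    · simp [h0, hmem, Real.sign_of_pos h0, two_mul, add_smul, add_assoc]
  · have hqD : q ∉ D := by
      rw [hpages]
      rintro ⟨θ, hθ, hqθ⟩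
      exact hmem (by rw [hα, (mem_linearPage_iff hq).1 hqθ]; exact hθ)
    refine HasJump.of_isNormal (Or.inl ⟨hqD, rfl⟩) c ?_
    filter_upwards [nhdsWithin_le_nhds hc] with x hx
    rw [hx]; simp [hmem]

theorem planar_add_smul_pageDir (h : IsBook D L label p e₁ e₂ Θ κ) (t : ℝ) (θ : Real.Angle) :
    planar e₁ e₂ (p + t • pageDir e₁ e₂ θ) = t * ((θ.cos : ℂ) + θ.sin * Complex.I) := by
  have := planar_pageDir h.pair θ
  simp only [planar, Complex.ext_iff] at this
  apply Complex.ext <;>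
  simp [planar, lorentz_add_left, lorentz_smul_left, h.mem₁, h.mem₂, this.1, this.2]

theorem planar_add_smul_pageDir_ne_zero (h : IsBook D L label p e₁ e₂ Θ κ) {t : ℝ} (ht : 0 < t)
    (θ : Real.Angle) : planar e₁ e₂ (p + t • pageDir e₁ e₂ θ) ≠ 0 := by
  rw [h.planar_add_smul_pageDir]
  refine mul_ne_zero (by exact_mod_cast ht.ne') fun h0 => ?_
  have h1 : θ.cos = 0 := by simpa using congrArg Complex.re h0
  have h2 : θ.sin = 0 := by simpa using congrArg Complex.im h0
  have := θ.cos_sq_add_sin_sq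
  simp [h1, h2] at this

theorem add_smul_pageDir_mem_linearPage_iff (h : IsBook D L label p e₁ e₂ Θ κ) {t : ℝ}
    (ht : 0 < t) (θ φ : Real.Angle) :
    p + t • pageDir e₁ e₂ θ ∈ linearPage e₁ e₂ φ ↔ θ = φ := by
  rw [mem_linearPage_iff (h.planar_add_smul_pageDir_ne_zero ht θ), h.planar_add_smul_pageDir,
    Complex.arg_mul_cos_add_sin_mul_I_coe_angle ht]

/-- Only finitely many angles carry pages, so a short step from `p` at any other angle leaves `D`.
-/
theorem exists_notMem (h : IsBook D L label p e₁ e₂ Θ κ) {P : Mink n → Prop}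
    (hP : ∀ᶠ x in 𝓝 p, P x) : ∃ x, P x ∧ x ∉ D := by
  obtain ⟨s, hs, hs'⟩ : ∃ s ∈ Set.Ioo 0 Real.pi, s ∉ Real.Angle.toReal '' (Θ : Set Real.Angle) :=
    (Set.Ioo_infinite Real.pi_pos).exists_notMem_finite (Θ.finite_toSet.image _)
  have hφ : (s : Real.Angle) ∉ Θ := fun h' => hs' ⟨_, h',
    Real.Angle.toReal_coe_eq_self_iff.2 ⟨by linarith [hs.1, Real.pi_pos], hs.2.le⟩⟩
  obtain ⟨t, ht, h1, h2⟩ := exists_pos_add_smul (hP.and h.pages) (pageDir e₁ e₂ s)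
  refine ⟨_, h1, fun hD => hφ ?_⟩
  obtain ⟨θ, hθ, hx⟩ := h2.1 hD
  rw [h.add_smul_pageDir_mem_linearPage_iff ht] at hx
  exact hx ▸ hθ

/-- Translation along the binding: solvability of the jump problem does not depend on the point of
the binding. -/
theorem exists_hasJump_of_mem (h : IsBook D L label p e₁ e₂ Θ κ) (w : K → ℝ) :
    ∀ᶠ q in 𝓝 p, q ∈ L →
      (∃ f, ∀ᶠ r in 𝓝 q, r ∉ L → HasJump D (fun x => w (label x)) f r) →
        ∃ f, ∀ᶠ r in 𝓝 p, r ∉ L → HasJump D (fun x => w (label x)) f r := by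
  have hev := h.eventually_isUnitNormal.and (h.locus.and (h.pages.and h.label_eq))
  filter_upwards [eventually_eventually_nhds.2 hev, h.locus] with q hqev hq hqL
  rintro ⟨f, hf⟩
  obtain ⟨hq1, hq2⟩ := hq.1 hqL
  -- Since `v` is parallel to the binding, translation by `v` keeps the planar coordinates and hence
  -- the pages. Labels match too, both points being close enough to `p` for `κ` to apply.
  set v := q - p with hv
  have hv1 : lorentz v e₁ = 0 := by rw [hv, lorentz_sub_left, hq1, h.mem₁, sub_zero]
  have hv2 : lorentz v e₂ = 0 := by rw [hv, lorentz_sub_left, hq2, h.mem₂, sub_zero]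
  have hl1 : ∀ x, lorentz (x + v) e₁ = lorentz x e₁ := fun x => by
    rw [lorentz_add_left, hv1, add_zero]
  have hl2 : ∀ x, lorentz (x + v) e₂ = lorentz x e₂ := fun x => by
    rw [lorentz_add_left, hv2, add_zero]
  have hpl : ∀ x, planar e₁ e₂ (x + v) = planar e₁ e₂ x := fun x => by
    rw [planar, planar, hl1, hl2]
  have hpage : ∀ x θ, x + v ∈ linearPage e₁ e₂ θ ↔ x ∈ linearPage e₁ e₂ θ := fun x θ => by
    simp only [linearPage, Set.mem_ofPred_eq, lorentz_pageNormal, lorentz_pageDir, hpl]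
  have htr : ∀ r, Tendsto (fun x => x + v) (𝓝 r) (𝓝 (r + v)) := fun r =>
    (continuous_add_const v).tendsto r
  have hpq : p + v = q := by rw [hv]; abel
  have htp := htr p
  rw [hpq] at htp
  refine ⟨fun x => f (x + v), ?_⟩
  filter_upwards [eventually_eventually_nhds.2 hev, htp.eventually hf,
    htp.eventually (eventually_eventually_nhds.2 hqev)] with r hr hfr hrv hrL
  obtain ⟨hrN, hrlocus, hrpages, hrlabel⟩ := hr.self_of_nhds
  obtain ⟨hrN', hrlocus', hrpages', hrlabel'⟩ := hrv.self_of_nhds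
  have hD : ∀ᶠ x in 𝓝 r, (x + v ∈ D ↔ x ∈ D) := by
    filter_upwards [hr, (htr r).eventually hrv] with x hx hxv
    rw [hx.2.2.1, hxv.2.2.1]
    simp only [hpage]
  have hrL' : r + v ∉ L := by rw [hrlocus', hl1, hl2, ← hrlocus]; exact hrL
  have hfr := hfr hrL'
  have hlim : Tendsto (fun x => x + v) (𝓝[Dᶜ] r) (𝓝[Dᶜ] (r + v)) := by
    refine tendsto_nhdsWithin_iff.2 ⟨(htr r).mono_left nhdsWithin_le_nhds, ?_⟩
    filter_upwards [nhdsWithin_le_nhds hD, self_mem_nhdsWithin] with x hx hx' hxv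
    exact hx' (hx.1 hxv)
  by_cases hrD : r ∈ D
  · obtain ⟨θ, hθ, hrθ⟩ := hrpages.1 hrD
    have hrθ' := (hpage r θ).2 hrθ
    obtain ⟨c, hc⟩ := hfr _ (Or.inr (hrN' hrL' θ hθ hrθ'))
    refine HasJump.of_isNormal (Or.inr (hrN hrL θ hθ hrθ)) c ?_
    filter_upwards [hlim.eventually hc] with x hx
    rw [hx, hrlabel' θ hθ hrθ' hrL', hrlabel θ hθ hrθ hrL, lorentz_pageNormal, lorentz_pageNormal,
      hpl]
  · have hrD' : r + v ∉ D := by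
      rw [hD.self_of_nhds]; exact hrD
    obtain ⟨c, hc⟩ := hfr 0 (Or.inl ⟨hrD', rfl⟩)
    refine HasJump.of_isNormal (Or.inl ⟨hrD, rfl⟩) c ?_
    filter_upwards [hlim.eventually hc] with x hx
    simpa using hx

end IsBook

end Book

/-- A function that is constant off `D` near each point of an open preconnected set is constant
off `D` on this set. -/
theorem IsPreconnected.exists_eq_of_eventually_eq {X V : Type*} [TopologicalSpace X] {S D : Set X}
    (hS : IsPreconnected S) (hD : ∀ p ∈ S, (𝓝[Dᶜ] p).NeBot) {h : X → V} [Nonempty V]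
    (hloc : ∀ p ∈ S, ∃ c, ∀ᶠ x in 𝓝[Dᶜ] p, h x = c) : ∃ c, ∀ x ∈ S, x ∉ D → h x = c := by
  rcases S.eq_empty_or_nonempty with rfl | ⟨x₀, hx₀⟩
  · exact ⟨Classical.arbitrary V, by simp⟩
  choose! c hc using hloc
  -- Close to `q` both constants are values of `h` at a common point off `D`, which exists because
  -- `q` is in the closure of the complement.
  have hlc : ∀ p ∈ S, ∀ᶠ q in 𝓝 p, q ∈ S → c q = c p := fun p hp => by
    filter_upwards [eventually_nhds_nhdsWithin.2 (hc p hp)] with q hq hqS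
    have := hD q hqS
    obtain ⟨x, h1, h2⟩ := (hq.and (hc q hqS)).exists
    rw [← h1, ← h2]
  let : TopologicalSpace V := ⊥
  have : DiscreteTopology V := ⟨rfl⟩
  have hcont : ContinuousOn c S := fun p hp => by
    refine Tendsto.congr' ?_ (tendsto_const_nhds (x := c p))
    filter_upwards [nhdsWithin_le_nhds (hlc p hp), self_mem_nhdsWithin] with q h1 h2
    exact (h1 h2).symm
  refine ⟨c x₀, fun x hx hxD => ?_⟩
  rw [hS.constant hcont hx₀ hx]
  exact eventually_nhdsWithin_iff.1 (hc x hx) |>.self_of_nhds hxD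

/-! ### Complements of codimension-two subspaces -/

section Plane

variable {n : ℕ} {e₁ e₂ p : Mink n}

/-- The set is covered by four convex pieces, the parts of `N` in the open half-spaces given by
`±e₁` and `±e₂`. Successive pieces meet near `p`. -/
theorem isPreconnected_inter_planar_ne_zero (h : IsSpacelikePair e₁ e₂) {N : Set (Mink n)}
    (hN : IsOpen N) (hconv : Convex ℝ N) (hp : p ∈ N) (hp0 : planar e₁ e₂ p = 0) :
    IsPreconnected (N ∩ {x | planar e₁ e₂ x ≠ 0}) := by
  obtain ⟨h1, h2, h12⟩ := h
  have h21 : lorentz e₂ e₁ = 0 := by rw [lorentz_comm, h12]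
  obtain ⟨hp1, hp2⟩ := (planar_eq_zero_iff p).1 hp0
  have key : ∀ ν : Mink n, IsPreconnected (N ∩ {x | 0 < lorentz x ν}) := fun ν =>
    (hconv.inter (convex_lorentz_pos ν)).isPreconnected
  have meet : ∀ ν μ : Mink n, (∃ v, 0 < lorentz v ν ∧ 0 < lorentz v μ) →
      lorentz p ν = 0 → lorentz p μ = 0 →
      ((N ∩ {x | 0 < lorentz x ν}) ∩ (N ∩ {x | 0 < lorentz x μ})).Nonempty := by
    rintro ν μ ⟨v, hv, hv'⟩ hν hμ
    obtain ⟨t, ht, htN⟩ := exists_pos_add_smul (hN.mem_nhds hp) v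
    refine ⟨p + t • v, ⟨htN, ?_⟩, htN, ?_⟩ <;>
    simp only [Set.mem_ofPred_eq, lorentz_add_left, lorentz_smul_left, hν, hμ] <;> positivity
  have e : N ∩ {x | planar e₁ e₂ x ≠ 0} =
      (N ∩ {x | 0 < lorentz x e₁} ∪ N ∩ {x | 0 < lorentz x e₂}) ∪
      (N ∩ {x | 0 < lorentz x (-e₁)} ∪ N ∩ {x | 0 < lorentz x (-e₂)}) := by
    ext x
    simp only [Set.mem_inter_iff, Set.mem_union, Set.mem_ofPred_eq, lorentz_neg_right, ne_eq,
      planar_eq_zero_iff, not_and_or, neg_pos]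
    constructor
    · rintro ⟨hx, h | h⟩ <;> rcases lt_or_gt_of_ne h with h | h <;> simp [hx, h]
    · rintro ((⟨hx, h⟩ | ⟨hx, h⟩) | (⟨hx, h⟩ | ⟨hx, h⟩)) <;> simp [hx, h.ne, h.ne']
  rw [e]
  have hp1' : lorentz p (-e₁) = 0 := by rw [lorentz_neg_right, hp1, neg_zero]
  have hp2' : lorentz p (-e₂) = 0 := by rw [lorentz_neg_right, hp2, neg_zero]
  refine IsPreconnected.union' ?_ (IsPreconnected.union' ?_ (key _) (key _))
    (IsPreconnected.union' ?_ (key _) (key _))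
  · refine (meet e₂ (-e₁) ⟨e₂ - e₁, ?_⟩ hp2 hp1').mono
      (Set.inter_subset_inter Set.subset_union_right Set.subset_union_left)
    simp [lorentz_sub_left, lorentz_neg_right, h1, h2, h12, h21]
  · refine meet e₁ e₂ ⟨e₁ + e₂, ?_⟩ hp1 hp2
    simp [lorentz_add_left, h1, h2, h12, h21]
  · refine meet (-e₁) (-e₂) ⟨-e₁ - e₂, ?_⟩ hp1' hp2'
    simp [lorentz_sub_left, lorentz_neg_left, lorentz_neg_right, h1, h2, h12, h21]

end Plane

/-! ### Branched hypersurfaces in convex sets -/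

/-- A branched linear hypersurface `D` with branching locus `L` in an open convex set `C`, whose
smooth pieces are labelled. -/
structure BranchedCone (n : ℕ) (K : Type*) where
  /-- the ambient open convex set -/
  C : Set (Mink n)
  /-- the hypersurface -/
  D : Set (Mink n)
  /-- the branching locus -/
  L : Set (Mink n)
  /-- the label of a smooth point -/
  label : Mink n → K
  isOpen : IsOpen C
  convex : Convex ℝ C
  locus_subset : L ⊆ D
  eventually_notMem : ∀ p ∈ C, p ∉ D → ∀ᶠ x in 𝓝 p, x ∉ D
  flat : ∀ p ∈ C, p ∈ D → p ∉ L →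
    ∃ ν, IsUnitNormal D p ν ∧ ∀ᶠ x in 𝓝 p, x ∈ D → label x = label p
  branch : ∀ p ∈ C, p ∈ L → ∃ e₁ e₂ Θ κ, IsBook D L label p e₁ e₂ Θ κ

namespace BranchedCone

variable {n : ℕ} {K : Type*} (T : BranchedCone n K)

theorem exists_isNormal {p : Mink n} (hp : p ∈ T.C) (hL : p ∉ T.L) : ∃ ν, IsNormal T.D p ν := by
  by_cases hD : p ∈ T.D
  · obtain ⟨ν, hν, _⟩ := T.flat p hp hD hL
    exact ⟨ν, Or.inr hν⟩
  · exact ⟨0, Or.inl ⟨hD, rfl⟩⟩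

/-- The hypersurface has empty interior: a smooth point leaves it along the normal, a branch point
between the pages. -/
theorem neBot {p : Mink n} (hp : p ∈ T.C) : (𝓝[T.Dᶜ] p).NeBot := by
  rw [← mem_closure_iff_nhdsWithin_neBot, mem_closure_iff_frequently]
  by_cases hD : p ∈ T.D
  · by_cases hL : p ∈ T.L
    · obtain ⟨e₁, e₂, Θ, κ, hb⟩ := T.branch p hp hL
      intro h
      obtain ⟨x, h1, h2⟩ := hb.exists_notMem h
      exact h1 h2
    · obtain ⟨ν, hν, _⟩ := T.flat p hp hD hL
      intro h
      obtain ⟨t, ht, h1, h2⟩ := exists_pos_add_smul (h.and hν.eventually) ν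
      refine h1 fun hmem => ht.ne' ?_
      have := h2.1 hmem
      rwa [lorentz_add_left, lorentz_smul_left, hν.mem, hν.unit, zero_add, mul_one] at this
  · intro h
    exact h.self_of_nhds hD

/-- `f` has the jumps prescribed by the weights `w` at every smooth point of `S`. -/
def SolvesOn (w : K → ℝ) (f : Mink n → Mink n) (S : Set (Mink n)) : Prop :=
  ∀ p ∈ S, p ∉ T.L → HasJump T.D (fun x => w (T.label x)) f p

/-- The jump problem for the weights `w` can be solved near `p`. -/
def LocallySolvable (w : K → ℝ) (p : Mink n) : Prop :=
  ∃ f, ∀ᶠ q in 𝓝 p, q ∉ T.L → HasJump T.D (fun x => w (T.label x)) f q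

variable {T} {w : K → ℝ} {f g : Mink n → Mink n}

/-- Equal jumps cancel, so `f - g` is constant off `D` near each smooth point. Near a branch point
the same holds because a ball minus the binding is connected. Connectedness of `N` finishes the
argument. -/
theorem SolvesOn.exists_eq_add_const {N : Set (Mink n)} (hN : IsOpen N) (hconv : Convex ℝ N)
    (hNC : N ⊆ T.C) (hf : T.SolvesOn w f N) (hg : T.SolvesOn w g N) :
    ∃ c, ∀ x ∈ N, x ∉ T.D → f x = g x + c := by
  have hsmooth : ∀ p ∈ N, p ∉ T.L → ∃ c, ∀ᶠ x in 𝓝[T.Dᶜ] p, f x - g x = c := fun p hp hL => by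
    obtain ⟨ν, hν⟩ := T.exists_isNormal (hNC hp) hL
    exact (hf p hp hL).exists_sub_const (hg p hp hL) hν
  have hall : ∀ p ∈ N, ∃ c, ∀ᶠ x in 𝓝[T.Dᶜ] p, f x - g x = c := by
    intro p hp
    by_cases hL : p ∈ T.L
    · obtain ⟨e₁, e₂, Θ, κ, hb⟩ := T.branch p (hNC hp) hL
      obtain ⟨r, hr, hball⟩ := Metric.eventually_nhds_iff_ball.1 (hb.locus.and (hN.mem_nhds hp))
      have hpre := isPreconnected_inter_planar_ne_zero hb.pair Metric.isOpen_ball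
        (convex_ball p r) (Metric.mem_ball_self hr)
        ((planar_eq_zero_iff p).2 ⟨hb.mem₁, hb.mem₂⟩)
      obtain ⟨c, hc⟩ := IsPreconnected.exists_eq_of_eventually_eq (D := T.D)
        (h := fun x => f x - g x) hpre (fun x hx => T.neBot (hNC (hball x hx.1).2))
        (fun x hx => hsmooth x (hball x hx.1).2 fun hxL =>
          hx.2 ((planar_eq_zero_iff x).2 ((hball x hx.1).1.1 hxL)))
      refine ⟨c, ?_⟩
      filter_upwards [nhdsWithin_le_nhds (Metric.ball_mem_nhds p hr), self_mem_nhdsWithin]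
        with x hx hxD
      exact hc x ⟨hx, fun h0 => hxD (T.locus_subset
        ((hball x hx).1.2 ((planar_eq_zero_iff x).1 h0)))⟩ hxD
    · exact hsmooth p hp hL
  obtain ⟨c, hc⟩ := IsPreconnected.exists_eq_of_eventually_eq (D := T.D) hconv.isPreconnected
    (fun x hx => T.neBot (hNC hx)) hall
  exact ⟨c, fun x hx hxD => by rw [← hc x hx hxD]; abel⟩

theorem locallySolvable_of_notMem_locus {p : Mink n} (hp : p ∈ T.C) (hL : p ∉ T.L) (w : K → ℝ) :
    T.LocallySolvable w p := by
  by_cases hD : p ∈ T.D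
  · obtain ⟨ν, hν, hlabel⟩ := T.flat p hp hD hL
    refine ⟨fun x => w (T.label p) • Real.sign (lorentz x ν) • ν, ?_⟩
    filter_upwards [eventually_eventually_nhds.2 hν.eventually, hlabel,
      T.isOpen.mem_nhds hp] with q hq hq' hqC hqL
    by_cases hqD : q ∈ T.D
    · refine HasJump.of_isNormal (ν := ν)
        (Or.inr ⟨hν.unit, hq.self_of_nhds.1 hqD, hq⟩) 0 (Eventually.of_forall fun x => ?_)
      simp only [hq' hqD, zero_add]
    · have hne : lorentz q ν ≠ 0 := fun h => hqD (hq.self_of_nhds.2 h)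
      refine HasJump.of_isNormal (Or.inl ⟨hqD, rfl⟩)
        (w (T.label p) • Real.sign (lorentz q ν) • ν) (nhdsWithin_le_nhds ?_)
      have hc : Tendsto (fun x : Mink n => lorentz x ν) (𝓝 q) (𝓝 (lorentz q ν)) :=
        (show Continuous fun x : Mink n => lorentz x ν by fun_prop).tendsto q
      rcases hne.lt_or_gt with h | h
      · filter_upwards [hc.eventually_lt_const h] with x hx
        rw [Real.sign_of_neg h, Real.sign_of_neg hx]; simp
      · filter_upwards [hc.eventually_const_lt h] with x hx
        rw [Real.sign_of_pos h, Real.sign_of_pos hx]; simp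
  · refine ⟨0, ?_⟩
    filter_upwards [T.eventually_notMem p hp hD] with q hq _
    exact HasJump.of_isNormal (Or.inl ⟨hq, rfl⟩) 0 (Eventually.of_forall fun x => by simp)

/-- A solution near `p` also serves nearby points; conversely, a solution near `q` is translated
back along the binding. -/
theorem eventually_locallySolvable_iff {p : Mink n} (hp : p ∈ T.C) (hL : p ∈ T.L) (w : K → ℝ) :
    ∀ᶠ q in 𝓝 p, q ∈ T.L → (T.LocallySolvable w q ↔ T.LocallySolvable w p) := by
  obtain ⟨e₁, e₂, Θ, κ, hb⟩ := T.branch p hp hL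
  by_cases h : T.LocallySolvable w p
  · obtain ⟨f, hf⟩ := id h
    filter_upwards [eventually_eventually_nhds.2 hf] with q hq _
    exact ⟨fun _ => h, fun _ => ⟨f, hq⟩⟩
  · filter_upwards [hb.exists_hasJump_of_mem w] with q hq hqL
    exact ⟨hq hqL, fun h' => absurd h' h⟩

theorem SolvesOn.add_const {S : Set (Mink n)} (h : T.SolvesOn w f S) (v : Mink n) :
    T.SolvesOn w (fun x => f x + v) S :=
  fun p hp hL => (h p hp hL).add_const v

/-- If the jump problem is solvable near each point, it is solvable. -/
theorem exists_solvesOn (h : ∀ p ∈ T.C, T.LocallySolvable w p) : ∃ f, T.SolvesOn w f T.C := by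
  rcases T.C.eq_empty_or_nonempty with he | ⟨y, hy⟩
  · exact ⟨0, fun p hp => by simp [he] at hp⟩
  -- Solutions are normalized to vanish at `x₀`. The base point has to avoid `D` for the constant
  -- between two solutions to be readable there.
  obtain ⟨x₀, hx₀, hx₀D⟩ : ∃ x ∈ T.C, x ∉ T.D := by
    have := T.neBot hy
    have hC : ∀ᶠ x in 𝓝[T.Dᶜ] y, x ∈ T.C := nhdsWithin_le_nhds (T.isOpen.mem_nhds hy)
    obtain ⟨x, h1, h2⟩ := (hC.and self_mem_nhdsWithin).exists
    exact ⟨x, h1, h2⟩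
  -- Continuation from `x₀` to `x` is recorded by a solution on a convex neighbourhood of both.
  -- Convex sets have convex intersections, so uniqueness applies on overlaps.
  let P : Mink n → Prop := fun x => ∃ N : Set (Mink n), IsOpen N ∧ Convex ℝ N ∧ N ⊆ T.C ∧
    x₀ ∈ N ∧ x ∈ N ∧ ∃ f, T.SolvesOn w f N ∧ f x₀ = 0
  have hball : ∀ p ∈ T.C, ∃ r > 0, Metric.ball p r ⊆ T.C ∧
      ∃ f, T.SolvesOn w f (Metric.ball p r) := fun p hp => by
    obtain ⟨f, hf⟩ := h p hp
    obtain ⟨r, hr, hb⟩ := Metric.eventually_nhds_iff_ball.1 (hf.and (T.isOpen.mem_nhds hp))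
    exact ⟨r, hr, fun x hx => (hb x hx).2, f, fun x hx => (hb x hx).1⟩
  have hP₀ : P x₀ := by
    obtain ⟨r, hr, hC, f, hf⟩ := hball x₀ hx₀
    exact ⟨_, Metric.isOpen_ball, convex_ball _ _, hC, Metric.mem_ball_self hr,
      Metric.mem_ball_self hr, _, hf.add_const (-f x₀), by simp⟩
  have hPall : ∀ x ∈ T.C, P x := by
    intro x hx
    let γ : ℝ → Mink n := fun t => x₀ + t • (x - x₀)
    have hγ : Continuous γ := by fun_prop
    have hγ0 : γ 0 = x₀ := by simp [γ]
    have hγ1 : γ 1 = x := by simp [γ]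
    have hγC : ∀ t ∈ Set.Icc (0 : ℝ) 1, γ t ∈ T.C := fun t ht =>
      T.convex.add_smul_sub_mem hx₀ hx ht
    have hγconv : ∀ {N : Set (Mink n)}, Convex ℝ N → Convex ℝ (γ ⁻¹' N) := fun hN => by
      have : γ = AffineMap.lineMap x₀ x := by
        funext t; simp [γ, AffineMap.lineMap_apply, add_comm]
      rw [this]
      exact hN.affine_preimage _
    have hopen : IsOpen {t : ℝ | P (γ t)} := by
      refine isOpen_iff_mem_nhds.2 ?_
      rintro t ⟨N, hN, hconv, hNC, h0, hxN, hf⟩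
      filter_upwards [hγ.continuousAt.preimage_mem_nhds (hN.mem_nhds hxN)] with s hs
      exact ⟨N, hN, hconv, hNC, h0, hs, hf⟩
    have hsub : Set.Icc (0 : ℝ) 1 ⊆ {t : ℝ | P (γ t)} := by
      refine isPreconnected_Icc.subset_of_closure_inter_subset hopen
        ⟨0, by simp, by simpa [hγ0] using hP₀⟩ ?_
      rintro t ⟨htcl, ht⟩
      obtain ⟨r, hr, hBC, g, hg⟩ := hball (γ t) (hγC t ht)
      obtain ⟨s, hsB, N, hN, hconv, hNC, h0, hsN, f, hf, hf0⟩ := mem_closure_iff_nhds.1 htcl _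
        (hγ.continuousAt.preimage_mem_nhds (Metric.ball_mem_nhds (γ t) hr))
      have hB := Metric.isOpen_ball (x := γ t) (ε := r)
      have hBconv := convex_ball (γ t) r
      obtain ⟨c, hc⟩ := SolvesOn.exists_eq_add_const (hN.inter hB) (hconv.inter hBconv)
        (fun x hx => hNC hx.1) (fun p hp => hf p hp.1) (fun p hp => hg p hp.2)
      have hcover : γ '' Set.Icc 0 t ⊆ N ∪ Metric.ball (γ t) r := by
        rintro _ ⟨u, hu, rfl⟩
        rcases le_total u s with hus | hus
        · refine Or.inl ((hγconv hconv).ordConnected.out (x := 0) (y := s) ?_ hsN ⟨hu.1, hus⟩)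
          rw [Set.mem_preimage, hγ0]; exact h0
        · exact Or.inr ((hγconv hBconv).ordConnected.out hsB (Metric.mem_ball_self hr)
            ⟨hus, hu.2⟩)
      -- A thin tube around the compact segment fits into the union of the two domains and is again
      -- convex.
      obtain ⟨δ, hδ, hthick⟩ := (isCompact_Icc.image hγ).exists_thickening_subset_open
        (hN.union hB) hcover
      have himconv : Convex ℝ (γ '' Set.Icc 0 t) := by
        have : γ = AffineMap.lineMap x₀ x := by
          funext t; simp [γ, AffineMap.lineMap_apply, add_comm]
        rw [this]
        exact (convex_Icc 0 t).affine_image _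
      classical
      refine ⟨_, Metric.isOpen_thickening, himconv.thickening δ, hthick.trans
        (Set.union_subset hNC hBC), Metric.self_subset_thickening hδ _ ⟨0, ⟨le_rfl, ht.1⟩, hγ0⟩,
        Metric.self_subset_thickening hδ _ ⟨t, ⟨ht.1, le_rfl⟩, rfl⟩,
        fun x => if x ∈ N then f x else g x + c, ?_, by simp [h0, hf0]⟩
      intro q hq hqL
      rcases hthick hq with hqN | hqB
      · refine (hf q hqN hqL).congr ?_
        filter_upwards [nhdsWithin_le_nhds (hN.mem_nhds hqN)] with x hx
        simp [show x ∈ N from hx]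
      · refine ((hg q hqB hqL).add_const c).congr ?_
        filter_upwards [nhdsWithin_le_nhds (hB.mem_nhds hqB), self_mem_nhdsWithin] with x hx hxD
        by_cases hxN : x ∈ N
        · simp only [hxN, if_true]
          exact hc x ⟨hxN, hx⟩ hxD
        · simp [hxN]
    have := hsub (show (1 : ℝ) ∈ Set.Icc (0 : ℝ) 1 by simp)
    rwa [Set.mem_ofPred_eq, hγ1] at this
  choose! N hN hconv hNC h0 hxN F hF hF0 using hPall
  -- The normalization at `x₀` forces the chosen solutions to agree on overlaps off `D`, so the
  -- diagonal choice is near `p` the single solution `F p`.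
  refine ⟨fun x => F x x, fun p hp hL => (hF p hp p (hxN p hp) hL).congr ?_⟩
  filter_upwards [nhdsWithin_le_nhds ((hN p hp).mem_nhds (hxN p hp)), self_mem_nhdsWithin]
    with x hx hxD
  have hxC := hNC p hp hx
  obtain ⟨c, hc⟩ := SolvesOn.exists_eq_add_const ((hN x hxC).inter (hN p hp))
    ((hconv x hxC).inter (hconv p hp)) (fun y hy => hNC p hp hy.2)
    (fun q hq => hF x hxC q hq.1) (fun q hq => hF p hp q hq.2)
  have hc0 := hc x₀ ⟨h0 x hxC, h0 p hp⟩ hx₀D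
  rw [hF0 x hxC, hF0 p hp, zero_add] at hc0
  rw [hc x ⟨hxN x hxC, hx⟩ hxD, ← hc0, add_zero]

end BranchedCone

/-! ### Similarities of the Lorentz form -/

section Similarity

variable {n : ℕ} {D : Set (Mink n)} {A : Mink n ≃L[ℝ] Mink n} {s : ℝ} {p ν : Mink n}

theorem lorentz_smul_symm (hA : ∀ x y, lorentz (A x) (A y) = s ^ 2 * lorentz x y) (hs : 0 < s)
    (x ν : Mink n) : lorentz x (s • A.symm ν) = s⁻¹ * lorentz (A x) ν := by
  have := hA x (A.symm ν)
  rw [A.apply_symm_apply] at this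
  rw [lorentz_smul_right, this]
  field_simp

theorem IsNormal.smul_symm (hA : ∀ x y, lorentz (A x) (A y) = s ^ 2 * lorentz x y) (hs : 0 < s)
    (hD : ∀ x, A x ∈ D ↔ x ∈ D) (h : IsNormal D (A p) ν) : IsNormal D p (s • A.symm ν) := by
  rcases h with ⟨h, rfl⟩ | h
  · exact Or.inl ⟨fun h' => h ((hD p).2 h'), by simp⟩
  · refine Or.inr ⟨?_, ?_, ?_⟩
    · rw [lorentz_smul_symm hA hs, map_smul, A.apply_symm_apply, lorentz_smul_left, h.unit]
      field_simp
    · rw [lorentz_smul_symm hA hs, h.mem, mul_zero]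
    · filter_upwards [A.continuous.continuousAt.eventually h.eventually] with x hx
      rw [← hD, hx, lorentz_smul_symm hA hs, mul_eq_zero, or_iff_right (inv_pos.2 hs).ne']

/-- A similarity of ratio `s` stretches unit normals by `s`, and the factor `s⁻¹` restores the
prescribed jump. Isometries and dilations of the cone are treated together in this way. -/
theorem HasJump.map {w : Mink n → ℝ} {f : Mink n → Mink n}
    (hA : ∀ x y, lorentz (A x) (A y) = s ^ 2 * lorentz x y) (hs : 0 < s)
    (hD : ∀ x, A x ∈ D ↔ x ∈ D) (hw : w (A p) = w p) (h : HasJump D w f p) :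
    HasJump D w (fun x => s⁻¹ • A (f (A.symm x))) (A p) := by
  intro ν hν
  obtain ⟨c, hc⟩ := h _ (hν.smul_symm hA hs hD)
  refine ⟨s⁻¹ • A c, ?_⟩
  have hlim : Tendsto A.symm (𝓝[Dᶜ] (A p)) (𝓝[Dᶜ] p) := by
    refine tendsto_nhdsWithin_iff.2 ⟨?_, ?_⟩
    · have := (A.symm.continuous.tendsto (A p)).mono_left (nhdsWithin_le_nhds (s := Dᶜ))
      rwa [A.symm_apply_apply] at this
    · filter_upwards [self_mem_nhdsWithin] with x hx hx'
      rw [← hD, A.apply_symm_apply] at hx'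
      exact hx hx'
  filter_upwards [hlim.eventually hc] with x hx
  have hsign : Real.sign (s⁻¹ * lorentz x ν) = Real.sign (lorentz x ν) := by
    rcases lt_trichotomy (lorentz x ν) 0 with h | h | h
    · rw [Real.sign_of_neg h, Real.sign_of_neg (mul_neg_of_pos_of_neg (inv_pos.2 hs) h)]
    · simp [h]
    · rw [Real.sign_of_pos h, Real.sign_of_pos (mul_pos (inv_pos.2 hs) h)]
  rw [hx, lorentz_smul_symm hA hs, A.apply_symm_apply, hsign, hw, map_add, map_smul, map_smul,
    map_smul, A.apply_symm_apply, smul_add]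
  congr 1
  simp only [smul_smul]
  congr 1
  field_simp

theorem BranchedCone.LocallySolvable.map {K : Type*} {T : BranchedCone n K} {w : K → ℝ}
    (hA : ∀ x y, lorentz (A x) (A y) = s ^ 2 * lorentz x y) (hs : 0 < s)
    (hD : ∀ x, A x ∈ T.D ↔ x ∈ T.D) (hL : ∀ x, A x ∈ T.L ↔ x ∈ T.L)
    (hlabel : ∀ x, T.label (A x) = T.label x) (h : T.LocallySolvable w p) :
    T.LocallySolvable w (A p) := by
  obtain ⟨f, hf⟩ := h
  refine ⟨fun x => s⁻¹ • A (f (A.symm x)), ?_⟩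
  have hlim : Tendsto A.symm (𝓝 (A p)) (𝓝 p) := by
    simpa using A.symm.continuous.tendsto (A p)
  filter_upwards [hlim.eventually hf] with q hq hqL
  have hq' : A.symm q ∉ T.L := by rwa [← hL, A.apply_symm_apply]
  have := (hq hq').map hA hs hD (by simp only [hlabel])
  rwa [A.apply_symm_apply] at this

end Similarity

/-! ### The future cone -/

section Cone

variable {n : ℕ}

/-- The open future cone, which is the union of the open rays through the hyperboloid. -/
def futureCone (n : ℕ) : Set (Mink n) := {x | lorentz x x < 0 ∧ 0 < x 0}

theorem isOpen_futureCone : IsOpen (futureCone n) :=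
  (isOpen_lt (f := fun x : Mink n => lorentz x x) (g := fun _ => (0 : ℝ)) (by fun_prop)
    continuous_const).inter (isOpen_lt continuous_const (continuous_apply 0))

/-- By Cauchy–Schwarz for the space-like coordinates, their inner product is smaller in absolute
value than the product of the time coordinates. -/
theorem lorentz_neg_of_mem_futureCone {x y : Mink n} (hx : x ∈ futureCone n)
    (hy : y ∈ futureCone n) : lorentz x y < 0 := by
  obtain ⟨hx, hx0⟩ := hx
  obtain ⟨hy, hy0⟩ := hy
  unfold lorentz at *
  have h := Finset.sum_mul_sq_le_sq_mul_sq Finset.univ (fun i : Fin n => x i.succ)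
    (fun i => y i.succ)
  have h1 : ∑ i : Fin n, x i.succ ^ 2 < x 0 ^ 2 := by simp only [pow_two]; linarith
  have h2 : ∑ i : Fin n, y i.succ ^ 2 < y 0 ^ 2 := by simp only [pow_two]; linarith
  have h3 : (∑ i : Fin n, x i.succ * y i.succ) ^ 2 < (x 0 * y 0) ^ 2 := by
    rw [mul_pow]
    exact h.trans_lt (mul_lt_mul'' h1 h2 (Finset.sum_nonneg fun _ _ => sq_nonneg _)
      (Finset.sum_nonneg fun _ _ => sq_nonneg _))
  have := lt_of_pow_lt_pow_left₀ 2 (by positivity) h3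
  linarith

theorem convex_futureCone : Convex ℝ (futureCone n) := by
  rw [convex_iff_forall_pos]
  intro x hx y hy a b ha hb _
  have hxy := lorentz_neg_of_mem_futureCone hx hy
  obtain ⟨hx, hx0⟩ := hx
  obtain ⟨hy, hy0⟩ := hy
  refine ⟨?_, ?_⟩
  · simp only [lorentz_add_left, lorentz_add_right, lorentz_smul_left, lorentz_smul_right,
      lorentz_comm y x]
    have h1 := mul_neg_of_pos_of_neg (mul_pos ha ha) hx
    have h2 := mul_neg_of_pos_of_neg (mul_pos hb hb) hy
    have h3 := mul_neg_of_pos_of_neg (mul_pos ha hb) hxy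
    nlinarith
  · simp only [Pi.add_apply, Pi.smul_apply, smul_eq_mul]; positivity

theorem smul_mem_futureCone {s : ℝ} (hs : 0 < s) {x : Mink n} (hx : x ∈ futureCone n) :
    s • x ∈ futureCone n := by
  obtain ⟨hx, hx0⟩ := hx
  refine ⟨?_, by simp only [Pi.smul_apply, smul_eq_mul]; positivity⟩
  rw [lorentz_smul_left, lorentz_smul_right, ← mul_assoc]
  exact mul_neg_of_pos_of_neg (by positivity) hx

theorem smul_mem_futureCone_iff {s : ℝ} (hs : 0 < s) {x : Mink n} :
    s • x ∈ futureCone n ↔ x ∈ futureCone n := by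
  refine ⟨fun h => ?_, smul_mem_futureCone hs⟩
  have := smul_mem_futureCone (inv_pos.2 hs) h
  rwa [inv_smul_smul₀ hs.ne'] at this

theorem val_mem_futureCone (x : Hyp n) : x.val ∈ futureCone n :=
  ⟨by rw [x.property.1]; norm_num, x.property.2⟩

theorem pos_of_lorentz_neg {x y : Mink n} (hx : x ∈ futureCone n) (hy : lorentz y y < 0)
    (h : lorentz x y < 0) : 0 < y 0 := by
  rcases lt_trichotomy (y 0) 0 with h0 | h0 | h0
  · have := lorentz_neg_of_mem_futureCone hx (y := -y)
      ⟨by rw [lorentz_neg_left, lorentz_neg_right, neg_neg]; exact hy, by simpa using h0⟩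
    rw [lorentz_neg_right] at this
    linarith
  · simp only [lorentz, h0, mul_zero, neg_zero, zero_add] at hy
    have := Finset.sum_nonneg fun (i : Fin n) (_ : i ∈ Finset.univ) =>
      mul_self_nonneg (y i.succ)
    linarith
  · exact h0

/-- The base point of hyperbolic space. -/
def hypBase (n : ℕ) : Hyp n := ⟨Pi.single 0 1, by simp [hyperboloid, lorentz]⟩

theorem normalize_mem {x : Mink n} (hx : x ∈ futureCone n) :
    (√(-lorentz x x))⁻¹ • x ∈ hyperboloid n := by
  have hpos : 0 < -lorentz x x := by linarith [hx.1]
  have hs := Real.sqrt_pos.2 hpos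
  refine ⟨?_, ?_⟩
  · rw [lorentz_smul_left, lorentz_smul_right, ← mul_assoc, ← mul_inv, Real.mul_self_sqrt hpos.le]
    field_simp
    rw [div_self hx.1.ne]
  · simp only [Pi.smul_apply, smul_eq_mul]
    exact mul_pos (inv_pos.2 hs) hx.2

open Classical in
/-- The radial projection of the future cone to hyperbolic space. -/
def radial (x : Mink n) : Hyp n :=
  if hx : x ∈ futureCone n then ⟨_, normalize_mem hx⟩ else hypBase n

theorem radial_val {x : Mink n} (hx : x ∈ futureCone n) :
    (radial x).val = (√(-lorentz x x))⁻¹ • x := by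
  rw [radial, dif_pos hx]

theorem exists_eq_smul_radial {x : Mink n} (hx : x ∈ futureCone n) :
    ∃ s : ℝ, 0 < s ∧ x = s • (radial x).val := by
  have hs : 0 < √(-lorentz x x) := Real.sqrt_pos.2 (by linarith [hx.1])
  exact ⟨_, hs, by rw [radial_val hx, smul_inv_smul₀ hs.ne']⟩

theorem radial_smul_val {s : ℝ} (hs : 0 < s) (y : Hyp n) : radial (s • y.val) = y := by
  apply Subtype.ext
  rw [radial_val (smul_mem_futureCone hs (val_mem_futureCone y)), lorentz_smul_left,
    lorentz_smul_right, y.property.1]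
  have : -(s * (s * -1)) = s ^ 2 := by ring
  rw [this, Real.sqrt_sq hs.le, inv_smul_smul₀ hs.ne']

theorem radial_val_self (y : Hyp n) : radial y.val = y := by
  simpa using radial_smul_val one_pos y

theorem radial_smul {s : ℝ} (hs : 0 < s) {x : Mink n} (hx : x ∈ futureCone n) :
    radial (s • x) = radial x := by
  obtain ⟨t, ht, h⟩ := exists_eq_smul_radial hx
  conv_lhs => rw [h, smul_smul]
  exact radial_smul_val (mul_pos hs ht) _

theorem continuousOn_radial : ContinuousOn (radial (n := n)) (futureCone n) := by
  rw [(Topology.IsInducing.subtypeVal (t := hyperboloid n)).continuousOn_iff]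
  have : ContinuousOn (fun x : Mink n => (√(-lorentz x x))⁻¹ • x) (futureCone n) := by
    have h1 : ContinuousOn (fun x : Mink n => √(-lorentz x x)) (futureCone n) :=
      (Real.continuous_sqrt.comp
        (continuous_lorentz continuous_id continuous_id).neg).continuousOn
    exact (h1.inv₀ fun x hx => (Real.sqrt_pos.2 (by linarith [hx.1])).ne').smul continuousOn_id
  exact this.congr fun x hx => radial_val hx

theorem lorentz_radial_eq_zero_iff {x ν : Mink n} (hx : x ∈ futureCone n) :
    lorentz (radial x).val ν = 0 ↔ lorentz x ν = 0 := by
  obtain ⟨s, hs, h⟩ := exists_eq_smul_radial hx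
  conv_rhs => rw [h, lorentz_smul_left, mul_eq_zero, or_iff_right hs.ne']

theorem lorentz_radial_nonneg_iff {x ν : Mink n} (hx : x ∈ futureCone n) :
    0 ≤ lorentz (radial x).val ν ↔ 0 ≤ lorentz x ν := by
  obtain ⟨s, hs, h⟩ := exists_eq_smul_radial hx
  conv_rhs => rw [h, lorentz_smul_left, mul_nonneg_iff_of_pos_left hs]

/-- An isometry of hyperbolic space, as a continuous linear automorphism. -/
def isom (g : OPlus n) : Mink n ≃L[ℝ] Mink n :=
  (LinearEquiv.ofLinearMap (Matrix.toLin' g.val.val) (Matrix.toLin' g.val.inv)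
    (by rw [← Matrix.toLin'_mul, g.val.val_inv, Matrix.toLin'_one])
    (by rw [← Matrix.toLin'_mul, g.val.inv_val, Matrix.toLin'_one])).toContinuousLinearEquiv

theorem isom_apply (g : OPlus n) (x : Mink n) : isom g x = g.val.val.mulVec x := rfl

theorem isom_val (g : OPlus n) (x : Hyp n) : isom g x.val = (g • x).val := rfl

theorem isom_mul (g h : OPlus n) (x : Mink n) :
    isom (g * h) x = isom g (isom h x) :=
  (Matrix.mulVec_mulVec x g.val.val h.val.val).symm

theorem isom_inv (g : OPlus n) (x : Mink n) : isom g⁻¹ x = (isom g).symm x := rfl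

theorem lorentz_isom (g : OPlus n) (x y : Mink n) :
    lorentz (isom g x) (isom g y) = lorentz x y := g.property.1 x y

theorem isom_mem_futureCone (g : OPlus n) {x : Mink n} (hx : x ∈ futureCone n) :
    isom g x ∈ futureCone n := by
  obtain ⟨s, hs, h⟩ := exists_eq_smul_radial hx
  rw [h, map_smul, isom_val]
  exact smul_mem_futureCone hs (val_mem_futureCone _)

theorem isom_mem_futureCone_iff (g : OPlus n) {x : Mink n} :
    isom g x ∈ futureCone n ↔ x ∈ futureCone n := by
  refine ⟨fun h => ?_, isom_mem_futureCone g⟩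
  have := isom_mem_futureCone g⁻¹ h
  rwa [isom_inv, (isom g).symm_apply_apply] at this

theorem radial_isom (g : OPlus n) {x : Mink n} (hx : x ∈ futureCone n) :
    radial (isom g x) = g • radial x := by
  obtain ⟨s, hs, h⟩ := exists_eq_smul_radial hx
  conv_lhs => rw [h, map_smul, isom_val]
  exact radial_smul_val hs _

/-- The cone over a set of points of hyperbolic space. -/
def coneOver (A : Set (Hyp n)) : Set (Mink n) := {x | x ∈ futureCone n ∧ radial x ∈ A}

theorem val_mem_coneOver_iff {A : Set (Hyp n)} (y : Hyp n) : y.val ∈ coneOver A ↔ y ∈ A := by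
  rw [coneOver, Set.mem_ofPred_eq, radial_val_self, and_iff_right (val_mem_futureCone y)]

theorem smul_mem_coneOver_iff {A : Set (Hyp n)} {s : ℝ} (hs : 0 < s) {x : Mink n} :
    s • x ∈ coneOver A ↔ x ∈ coneOver A := by
  rw [coneOver, Set.mem_ofPred_eq, Set.mem_ofPred_eq, smul_mem_futureCone_iff hs]
  exact and_congr_right fun hx => by rw [radial_smul hs hx]

theorem eventually_radial {p : Mink n} (hp : p ∈ futureCone n) {U : Set (Hyp n)} (hU : IsOpen U)
    (hpU : radial p ∈ U) : ∀ᶠ x in 𝓝 p, x ∈ futureCone n ∧ radial x ∈ U :=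
  Filter.Eventually.and (isOpen_futureCone.mem_nhds hp)
    ((continuousOn_radial.continuousAt (isOpen_futureCone.mem_nhds hp)).eventually
      (hU.mem_nhds hpU))

end Cone

/-! ### The cone over the lifted hypersurface -/

section Lift

variable {n : ℕ} {Γ : Subgroup (OPlus n)}

instance : ContinuousConstSMul Γ (Hyp n) where
  continuous_const_smul γ := by
    refine Continuous.subtype_mk ?_ _
    exact (isom (γ : OPlus n)).continuous.comp continuous_subtype_val

/-- The point of `M` below a point of the future cone. -/
def toMfd (Γ : Subgroup (OPlus n)) (x : Mink n) : Mfd Γ := Quotient.mk _ (radial x)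

theorem continuous_mk_mfd : Continuous fun x : Hyp n => (Quotient.mk _ x : Mfd Γ) :=
  continuous_quot_mk

theorem continuousOn_toMfd : ContinuousOn (toMfd Γ) (futureCone n) :=
  continuous_mk_mfd.comp_continuousOn continuousOn_radial

theorem mk_smul_mfd {γ : OPlus n} (hγ : γ ∈ Γ) (x : Hyp n) :
    (Quotient.mk _ (γ • x) : Mfd Γ) = Quotient.mk _ x :=
  Quotient.sound (MulAction.orbitRel_apply.2 ⟨⟨γ, hγ⟩, rfl⟩)

theorem toMfd_isom {γ : OPlus n} (hγ : γ ∈ Γ) {x : Mink n} (hx : x ∈ futureCone n) :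
    toMfd Γ (isom γ x) = toMfd Γ x := by
  rw [toMfd, radial_isom γ hx, mk_smul_mfd hγ, toMfd]

theorem isom_mem_coneOver_upstairs_iff {γ : OPlus n} (hγ : γ ∈ Γ) (A : Set (Mfd Γ)) (x : Mink n) :
    isom γ x ∈ coneOver (upstairs Γ A) ↔ x ∈ coneOver (upstairs Γ A) := by
  rw [coneOver, Set.mem_ofPred_eq, Set.mem_ofPred_eq, isom_mem_futureCone_iff]
  refine and_congr_right fun hx => ?_
  rw [radial_isom γ hx, upstairs, Set.mem_ofPred_eq, mk_smul_mfd hγ, Set.mem_ofPred_eq]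

open Classical in
/-- The connected component of the subset `A` of `M` below a point of the future cone. -/
def componentLabel (A : Set (Mfd Γ)) (x : Mink n) : Option (ConnectedComponents A) :=
  if h : x ∈ futureCone n ∧ toMfd Γ x ∈ A then
    some (ConnectedComponents.mk (⟨toMfd Γ x, h.2⟩ : A)) else none

theorem componentLabel_of_mem {A : Set (Mfd Γ)} {x : Mink n} (hx : x ∈ futureCone n)
    (hA : toMfd Γ x ∈ A) :
    componentLabel A x = some (ConnectedComponents.mk (⟨toMfd Γ x, hA⟩ : A)) :=
  dif_pos ⟨hx, hA⟩

theorem componentLabel_eq_of_isPreconnected {A : Set (Mfd Γ)} {S : Set (Mink n)}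
    (hS : IsPreconnected S) (hSA : ∀ x ∈ S, x ∈ futureCone n ∧ toMfd Γ x ∈ A) {x y : Mink n}
    (hx : x ∈ S) (hy : y ∈ S) : componentLabel A x = componentLabel A y := by
  have : PreconnectedSpace S := Subtype.preconnectedSpace hS
  let f : S → ConnectedComponents A := fun z => ConnectedComponents.mk ⟨toMfd Γ z, (hSA z z.2).2⟩
  have hf : Continuous f := ConnectedComponents.continuous_coe.comp
    ((continuousOn_toMfd.mono fun z hz => (hSA z hz).1).domRestrict.subtype_mk _)
  have := (isPreconnected_range hf).subsingleton (Set.mem_range_self (⟨x, hx⟩ : S))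
    (Set.mem_range_self (⟨y, hy⟩ : S))
  rw [componentLabel_of_mem (hSA x hx).1 (hSA x hx).2, componentLabel_of_mem (hSA y hy).1
    (hSA y hy).2]
  exact congrArg some this

theorem eventually_notMem_coneOver {A : Set (Mfd Γ)} (hA : IsClosed A) {p : Mink n}
    (hp : p ∈ futureCone n) (hpA : p ∉ coneOver (upstairs Γ A)) :
    ∀ᶠ x in 𝓝 p, x ∉ coneOver (upstairs Γ A) := by
  filter_upwards [eventually_radial hp (hA.preimage continuous_mk_mfd).isOpen_compl
    (fun h => hpA ⟨hp, h⟩)] with x hx hx'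
  exact hx.2 hx'.2

variable {Δ B : Set (Mfd Γ)}

theorem exists_isUnitNormal_coneOver (h : IsBranchedHypersurface Γ Δ B) {p : Mink n}
    (hp : p ∈ futureCone n) (hD : p ∈ coneOver (upstairs Γ Δ)) (hL : p ∉ coneOver (upstairs Γ B)) :
    ∃ ν, IsUnitNormal (coneOver (upstairs Γ Δ)) p ν ∧
      ∀ᶠ x in 𝓝 p, x ∈ coneOver (upstairs Γ Δ) →
        componentLabel (Δ \ B) x = componentLabel (Δ \ B) p := by
  obtain ⟨ν, hν, hpν, U, hU, hpU, hUeq⟩ := h.flat (radial p) ⟨hD.2, fun h => hL ⟨hp, h⟩⟩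
  have hmem : p ∈ {x | lorentz x ν = 0} := (lorentz_radial_eq_zero_iff hp).1 hpν
  have hev : ∀ᶠ x in 𝓝 p, (x ∈ coneOver (upstairs Γ Δ) ↔ lorentz x ν = 0) := by
    filter_upwards [eventually_radial hp hU hpU] with x hx
    rw [coneOver, Set.mem_ofPred_eq, and_iff_right hx.1, ← lorentz_radial_eq_zero_iff hx.1]
    have := Set.ext_iff.1 hUeq (radial x)
    simp only [Set.mem_inter_iff, hx.2, and_true] at this
    exact this
  refine ⟨ν, ⟨hν, hmem, hev⟩, ?_⟩
  obtain ⟨r, hr, hball⟩ := Metric.eventually_nhds_iff_ball.1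
    (hev.and (eventually_notMem_coneOver h.isClosed_locus hp hL))
  -- The piece of the hyperplane inside the ball is convex and avoids `B`, so it maps into one
  -- component of `Δ \ B`.
  have hpre := ((convex_ball p r).inter (convex_lorentz_eq_zero ν)).isPreconnected
  filter_upwards [Metric.ball_mem_nhds p hr] with x hx hxD
  refine componentLabel_eq_of_isPreconnected hpre (fun y hy => ?_)
    ⟨hx, (hball x hx).1.1 hxD⟩ ⟨Metric.mem_ball_self hr, hmem⟩
  have hyD := (hball y hy.1).1.2 hy.2
  exact ⟨hyD.1, hyD.2, fun hB => (hball y hy.1).2 ⟨hyD.1, hB⟩⟩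

theorem exists_isBook_coneOver (h : IsBranchedHypersurface Γ Δ B) {p : Mink n}
    (hp : p ∈ futureCone n) (hL : p ∈ coneOver (upstairs Γ B)) :
    ∃ e₁ e₂ Θ κ, IsBook (coneOver (upstairs Γ Δ)) (coneOver (upstairs Γ B))
      (componentLabel (Δ \ B)) p e₁ e₂ Θ κ := by
  obtain ⟨e₁, e₂, hpair, hpax, Θ, -, U, hU, hpU, hB, hΔ⟩ := h.branch (radial p) hL.2
  have hp1 := (lorentz_radial_eq_zero_iff hp).1 hpax.1
  have hp2 := (lorentz_radial_eq_zero_iff hp).1 hpax.2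
  have hlocus : ∀ᶠ x in 𝓝 p,
      (x ∈ coneOver (upstairs Γ B) ↔ lorentz x e₁ = 0 ∧ lorentz x e₂ = 0) := by
    filter_upwards [eventually_radial hp hU hpU] with x hx
    rw [coneOver, Set.mem_ofPred_eq, and_iff_right hx.1, ← lorentz_radial_eq_zero_iff hx.1,
      ← lorentz_radial_eq_zero_iff hx.1]
    have := Set.ext_iff.1 hB (radial x)
    simp only [Set.mem_inter_iff, hx.2, and_true] at this
    exact this
  have hpages : ∀ᶠ x in 𝓝 p,
      (x ∈ coneOver (upstairs Γ Δ) ↔ ∃ θ ∈ Θ, x ∈ linearPage e₁ e₂ θ) := by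
    filter_upwards [eventually_radial hp hU hpU] with x hx
    rw [coneOver, Set.mem_ofPred_eq, and_iff_right hx.1]
    have := Set.ext_iff.1 hΔ (radial x)
    simp only [Set.mem_inter_iff, hx.2, and_true, Set.mem_iUnion, exists_prop] at this
    rw [this]
    refine exists_congr fun θ => and_congr_right fun _ => ?_
    rw [linearPage, Set.mem_ofPred_eq, ← lorentz_radial_eq_zero_iff hx.1,
      ← lorentz_radial_nonneg_iff hx.1]
    rfl
  obtain ⟨r, hr, hball⟩ := Metric.eventually_nhds_iff_ball.1 (hlocus.and hpages)
  have hlabel : ∀ θ, ∃ k, ∀ x ∈ Metric.ball p r, θ ∈ Θ → x ∈ linearPage e₁ e₂ θ →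
      x ∉ coneOver (upstairs Γ B) → componentLabel (Δ \ B) x = k := by
    intro θ
    -- The open half of the page inside the ball is convex, which gives it a single label.
    set S := Metric.ball p r ∩ ({x | lorentz x (pageNormal e₁ e₂ θ) = 0} ∩
      {x | 0 < lorentz x (pageDir e₁ e₂ θ)}) with hS
    have hpre : IsPreconnected S := ((convex_ball p r).inter
      ((convex_lorentz_eq_zero _).inter (convex_lorentz_pos _))).isPreconnected
    have hmemS : ∀ x ∈ Metric.ball p r, x ∈ linearPage e₁ e₂ θ →
        x ∉ coneOver (upstairs Γ B) → x ∈ S := fun x hx hxθ hxB =>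
      ⟨hx, hxθ.1, lorentz_pageDir_pos
        (fun h0 => hxB ((hball x hx).1.2 ((planar_eq_zero_iff x).1 h0))) hxθ⟩
    by_cases hne : θ ∈ Θ ∧ S.Nonempty
    · obtain ⟨hθ, y, hy⟩ := hne
      refine ⟨componentLabel (Δ \ B) y, fun x hx _ hxθ hxB =>
        componentLabel_eq_of_isPreconnected hpre (fun z hz => ?_) (hmemS x hx hxθ hxB) hy⟩
      have hzD := (hball z hz.1).2.2 ⟨θ, hθ, hz.2.1, le_of_lt hz.2.2⟩
      refine ⟨hzD.1, hzD.2, fun hB => ?_⟩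
      have h0 := (planar_eq_zero_iff z).2 ((hball z hz.1).1.1 ⟨hzD.1, hB⟩)
      have := hz.2.2
      rw [Set.mem_ofPred_eq, lorentz_pageDir, h0] at this
      simp at this
    · exact ⟨none, fun x hx hθ hxθ hxB => absurd ⟨hθ, x, hmemS x hx hxθ hxB⟩ hne⟩
  choose κ hκ using hlabel
  refine ⟨e₁, e₂, Θ, κ, hpair, hp1, hp2, hlocus, hpages, ?_⟩
  filter_upwards [Metric.ball_mem_nhds p hr] with x hx θ hθ hxθ hxB
  exact hκ θ x hx hθ hxθ hxB

/-- The cone over the preimage of a branched totally geodesic hypersurface, labelled by the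
connected components of its smooth part. -/
def IsBranchedHypersurface.cone (h : IsBranchedHypersurface Γ Δ B) :
    BranchedCone n (Option (ConnectedComponents ↥(Δ \ B))) where
  C := futureCone n
  D := coneOver (upstairs Γ Δ)
  L := coneOver (upstairs Γ B)
  label := componentLabel (Δ \ B)
  isOpen := isOpen_futureCone
  convex := convex_futureCone
  locus_subset _ hx := ⟨hx.1, h.locus_subset hx.2⟩
  eventually_notMem _ hp hD := eventually_notMem_coneOver h.isClosed hp hD
  flat _ hp hD hL := exists_isUnitNormal_coneOver h hp hD hL
  branch _ hp hL := exists_isBook_coneOver h hp hL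

theorem componentLabel_congr (A : Set (Mfd Γ)) {x y : Mink n}
    (hC : x ∈ futureCone n ↔ y ∈ futureCone n)
    (hxy : y ∈ futureCone n → toMfd Γ x = toMfd Γ y) :
    componentLabel A x = componentLabel A y := by
  by_cases hy : y ∈ futureCone n ∧ toMfd Γ y ∈ A
  · have hx : toMfd Γ x ∈ A := by rw [hxy hy.1]; exact hy.2
    rw [componentLabel_of_mem (hC.2 hy.1) hx, componentLabel_of_mem hy.1 hy.2]
    congr 3
    exact hxy hy.1
  · have hx : ¬(x ∈ futureCone n ∧ toMfd Γ x ∈ A) := fun hx =>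
      hy ⟨hC.1 hx.1, hxy (hC.1 hx.1) ▸ hx.2⟩
    rw [componentLabel, componentLabel, dif_neg hx, dif_neg hy]

theorem componentLabel_isom {γ : OPlus n} (hγ : γ ∈ Γ) (A : Set (Mfd Γ)) (x : Mink n) :
    componentLabel A (isom γ x) = componentLabel A x :=
  componentLabel_congr A (isom_mem_futureCone_iff γ) (toMfd_isom hγ)

theorem componentLabel_smul {s : ℝ} (hs : 0 < s) (A : Set (Mfd Γ)) (x : Mink n) :
    componentLabel A (s • x) = componentLabel A x :=
  componentLabel_congr A (smul_mem_futureCone_iff hs) fun hx => by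
    rw [toMfd, radial_smul hs hx, toMfd]

variable {w : Option (ConnectedComponents ↥(Δ \ B)) → ℝ}

theorem LocallySolvable.isom (h : IsBranchedHypersurface Γ Δ B) {γ : OPlus n} (hγ : γ ∈ Γ)
    {p : Mink n} (hp : h.cone.LocallySolvable w p) :
    h.cone.LocallySolvable w (isom γ p) :=
  hp.map (s := 1) (fun x y => by rw [lorentz_isom]; ring) one_pos
    (isom_mem_coneOver_upstairs_iff hγ Δ) (isom_mem_coneOver_upstairs_iff hγ B)
    (componentLabel_isom hγ _)

theorem LocallySolvable.smul (h : IsBranchedHypersurface Γ Δ B) {s : ℝ} (hs : 0 < s)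
    {p : Mink n} (hp : h.cone.LocallySolvable w p) : h.cone.LocallySolvable w (s • p) :=
  hp.map (A := ContinuousLinearEquiv.smulLeft (Units.mk0 s hs.ne')) (s := s)
    (fun x y => by
      change lorentz (s • x) (s • y) = _
      rw [lorentz_smul_left, lorentz_smul_right]; ring) hs
    (fun _ => smul_mem_coneOver_iff hs) (fun _ => smul_mem_coneOver_iff hs)
    (componentLabel_smul hs _)

/-- Solvability of the jump problem only depends on the connected component of the branching
locus. -/
theorem locallySolvable_of_connectedComponent_eq (h : IsBranchedHypersurface Γ Δ B)
    {x y : Hyp n} (hx : x ∈ upstairs Γ B) (hy : y ∈ upstairs Γ B)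
    (hxy : ConnectedComponents.mk (⟨_, hx⟩ : B) = ConnectedComponents.mk (⟨_, hy⟩ : B))
    (hsol : h.cone.LocallySolvable w x.val) : h.cone.LocallySolvable w y.val := by
  let P : Hyp n → Prop := fun x => h.cone.LocallySolvable w x.val
  have hinv : ∀ x y : Hyp n, (Quotient.mk _ x : Mfd Γ) = Quotient.mk _ y → P x → P y := by
    intro x y hxy hPx
    obtain ⟨γ, hγ⟩ := MulAction.orbitRel_apply.1 (Quotient.exact hxy.symm)
    have := LocallySolvable.isom h γ.2 hPx
    rw [isom_val] at this
    exact hγ ▸ this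
  -- Local solvability is `Γ`-invariant, so it descends to `B`. The quotient map is open, so local
  -- constancy descends as well.
  let Q : B → Prop := fun b => ∃ x : Hyp n, (Quotient.mk _ x : Mfd Γ) = b ∧ P x
  have hQ : ∀ x (hx : x ∈ upstairs Γ B), Q ⟨_, hx⟩ ↔ P x := fun x hx =>
    ⟨fun ⟨z, hz, hPz⟩ => hinv z x hz hPz, fun hP => ⟨x, rfl, hP⟩⟩
  have hloc : IsLocallyConstant Q := by
    rw [IsLocallyConstant.iff_eventually_eq]
    rintro ⟨b, hb⟩
    obtain ⟨x, rfl⟩ := Quotient.exists_rep b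
    have hev := BranchedCone.eventually_locallySolvable_iff (T := h.cone)
      (val_mem_futureCone x) ((val_mem_coneOver_iff x).2 hb) w
    have hev : ∀ᶠ y : Hyp n in 𝓝 x, y ∈ upstairs Γ B → (P y ↔ P x) := by
      filter_upwards [continuous_subtype_val.continuousAt.eventually hev] with y hy hyB
      exact hy ((val_mem_coneOver_iff y).2 hyB)
    have hopen : IsOpenMap fun x : Hyp n => (Quotient.mk _ x : Mfd Γ) :=
      isOpenMap_quotient_mk'_mul
    have hnhds := hopen.image_mem_nhds hev
    filter_upwards [continuous_subtype_val.continuousAt.preimage_mem_nhds hnhds]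
    rintro ⟨c, hc⟩ ⟨y, hy, rfl⟩
    rw [hQ y hc, hQ x hb]
    exact propext (hy hc)
  have := hloc.apply_eq_of_isPreconnected isPreconnected_connectedComponent
    (mem_connectedComponent (x := (⟨_, hx⟩ : B)))
    (ConnectedComponents.coe_eq_coe'.1 hxy.symm)
  rw [hQ x hx, hQ y hy] at this
  exact this.mp hsol

/-- Two linear conditions on the weights for each component of the branching locus make the jump
problem solvable. -/
theorem exists_conditions (h : IsBranchedHypersurface Γ Δ B) :
    ∃ S : ConnectedComponents B → (Option (ConnectedComponents ↥(Δ \ B)) → ℝ) →ₗ[ℝ] (Fin 2 → ℝ),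
      ∀ w, (∀ b, S b w = 0) → ∃ f, h.cone.SolvesOn w f (futureCone n) := by
  have hrep : ∀ b : ConnectedComponents B, ∃ (x : Hyp n) (hx : x ∈ upstairs Γ B),
      ConnectedComponents.mk (⟨_, hx⟩ : B) = b := by
    intro b
    obtain ⟨⟨m, hm⟩, rfl⟩ := ConnectedComponents.surjective_coe b
    obtain ⟨x, rfl⟩ := Quotient.exists_rep m
    exact ⟨x, hm, rfl⟩
  choose x hx hxb using hrep
  choose e₁ e₂ Θ κ hbook using fun b =>
    exists_isBook_coneOver h (val_mem_futureCone (x b)) ((val_mem_coneOver_iff _).2 (hx b))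
  -- These are, up to sign, the `e₁` and `e₂` coordinates of the weighted sum of page normals at one
  -- chosen point over each component.
  refine ⟨fun b => LinearMap.pi ![∑ θ ∈ Θ b, θ.sin • LinearMap.proj (κ b θ),
    ∑ θ ∈ Θ b, θ.cos • LinearMap.proj (κ b θ)], fun w hw => ?_⟩
  refine BranchedCone.exists_solvesOn (T := h.cone) fun p hp => ?_
  by_cases hL : p ∈ h.cone.L
  · obtain ⟨s, hs, hps⟩ := exists_eq_smul_radial hp
    rw [hps]
    refine LocallySolvable.smul h hs ?_
    set b := ConnectedComponents.mk (⟨_, hL.2⟩ : B) with hb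
    refine locallySolvable_of_connectedComponent_eq h (hx b) hL.2 (hxb b) ?_
    refine (hbook b).exists_hasJump w ?_
    have h0 := congrFun (hw b) 0
    have h1 := congrFun (hw b) 1
    simp only [LinearMap.pi_apply, Matrix.cons_val_zero, Matrix.cons_val_one, LinearMap.sum_apply,
      LinearMap.smul_apply, LinearMap.proj_apply, smul_eq_mul, Pi.zero_apply] at h0 h1
    simp only [pageNormal, smul_add, Finset.sum_add_distrib, smul_smul, ← Finset.sum_smul]
    have h0' : ∑ θ ∈ Θ b, w (κ b θ) * -θ.sin = 0 := by
      rw [← neg_eq_zero, ← Finset.sum_neg_distrib, ← h0]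
      exact Finset.sum_congr rfl fun θ _ => by ring
    have h1' : ∑ θ ∈ Θ b, w (κ b θ) * θ.cos = 0 := by
      rw [← h1]
      exact Finset.sum_congr rfl fun θ _ => by ring
    rw [h0', h1']; simp
  · exact BranchedCone.locallySolvable_of_notMem_locus hp hL w

end Lift

/-! ### Vectors fixed by `SO⁺(n,1)` -/

section Reflection

variable {n : ℕ}

/-- The covector `⟨·, ν⟩`. -/
def dualVec (ν : Mink n) : Mink n := Fin.cons (-ν 0) fun i => ν i.succ

theorem dualVec_dotProduct (ν x : Mink n) : dualVec ν ⬝ᵥ x = lorentz x ν := by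
  simp [dualVec, dotProduct, lorentz, Fin.sum_univ_succ, mul_comm]

/-- The matrix of the reflection in the hyperplane orthogonal to `ν`. -/
def reflMatrix (ν : Mink n) : Matrix (Fin (n + 1)) (Fin (n + 1)) ℝ :=
  1 - Matrix.vecMulVec ((2 : ℝ) • ν) (dualVec ν)

theorem reflMatrix_mulVec (ν x : Mink n) :
    (reflMatrix ν).mulVec x = x - (2 * lorentz x ν) • ν := by
  rw [reflMatrix, Matrix.sub_mulVec, Matrix.one_mulVec, Matrix.vecMulVec_mulVec,
    dualVec_dotProduct]
  simp [smul_smul, mul_comm]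

variable {ν : Mink n}

theorem reflMatrix_mulVec_mulVec (hν : lorentz ν ν = 1) (x : Mink n) :
    (reflMatrix ν).mulVec ((reflMatrix ν).mulVec x) = x := by
  rw [reflMatrix_mulVec, reflMatrix_mulVec, lorentz_sub_left, lorentz_smul_left, hν, sub_sub,
    ← add_smul]
  ring_nf
  simp

theorem reflMatrix_mul_self (hν : lorentz ν ν = 1) : reflMatrix ν * reflMatrix ν = 1 := by
  refine Matrix.toLin'.injective (LinearMap.ext fun x => ?_)
  rw [Matrix.toLin'_mul, LinearMap.comp_apply, Matrix.toLin'_apply, Matrix.toLin'_apply,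
    reflMatrix_mulVec_mulVec hν, Matrix.toLin'_one, LinearMap.id_apply]

theorem lorentz_reflMatrix (hν : lorentz ν ν = 1) (x y : Mink n) :
    lorentz ((reflMatrix ν).mulVec x) ((reflMatrix ν).mulVec y) = lorentz x y := by
  simp only [reflMatrix_mulVec, lorentz_sub_left, lorentz_sub_right, lorentz_smul_left,
    lorentz_smul_right, hν, lorentz_comm ν y]
  ring

theorem reflMatrix_mem_hyperboloid (hν : lorentz ν ν = 1) {x : Mink n} (hx : x ∈ hyperboloid n) :
    (reflMatrix ν).mulVec x ∈ hyperboloid n := by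
  have h1 : lorentz ((reflMatrix ν).mulVec x) ((reflMatrix ν).mulVec x) = -1 := by
    rw [lorentz_reflMatrix hν, hx.1]
  refine ⟨h1, pos_of_lorentz_neg (val_mem_futureCone ⟨x, hx⟩) (by rw [h1]; norm_num) ?_⟩
  rw [reflMatrix_mulVec, lorentz_sub_right, lorentz_smul_right, hx.1]
  nlinarith [mul_self_nonneg (lorentz x ν)]

/-- The reflection in the hyperplane orthogonal to the unit vector `ν`. -/
def reflection (hν : lorentz ν ν = 1) : OPlus n :=
  ⟨⟨reflMatrix ν, reflMatrix ν, reflMatrix_mul_self hν, reflMatrix_mul_self hν⟩,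
    lorentz_reflMatrix hν, fun x => ⟨fun h => by
      have := reflMatrix_mem_hyperboloid hν h
      rwa [reflMatrix_mulVec_mulVec hν] at this, reflMatrix_mem_hyperboloid hν⟩⟩

/-- The matrix is a rank-one perturbation of the identity, so the matrix determinant lemma gives `1
- 2⟨ν, ν⟩`. -/
theorem det_reflMatrix (hν : lorentz ν ν = 1) : (reflMatrix ν).det = -1 := by
  have h := Matrix.det_one_add_replicateCol_mul_replicateRow (ι := Unit) ((-2 : ℝ) • ν) (dualVec ν)
  rw [dotProduct_smul, dualVec_dotProduct, hν, ← Matrix.vecMulVec_eq] at h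
  have e : reflMatrix ν = 1 + Matrix.vecMulVec ((-2 : ℝ) • ν) (dualVec ν) := by
    rw [reflMatrix, Matrix.smul_vecMulVec, Matrix.smul_vecMulVec, neg_smul, sub_eq_add_neg]
  rw [e, h]; norm_num

/-- Products of two reflections lie in `SO⁺(n,1)`. A vector fixed by the product for `ν` and `μ`
satisfies `⟨v, μ⟩μ = ⟨v, ν⟩ν`, so it is orthogonal to both when they are independent. -/
theorem eq_zero_of_forall_mem_SOPlus (hn : 1 ≤ n) {v : Mink n}
    (hv : ∀ g ∈ SOPlus n, isom g v = v) : v = 0 := by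
  have key : ∀ ν μ : Mink n, lorentz ν ν = 1 → lorentz μ μ = 1 →
      lorentz v μ • μ = lorentz v ν • ν := by
    intro ν μ hν hμ
    have h := hv (reflection hν * reflection hμ) (by
      change (reflMatrix ν * reflMatrix μ).det = 1
      rw [Matrix.det_mul, det_reflMatrix hν, det_reflMatrix hμ]; norm_num)
    rw [isom_mul] at h
    change (reflMatrix ν).mulVec ((reflMatrix μ).mulVec v) = v at h
    have h := congrArg (reflMatrix ν).mulVec h
    rw [reflMatrix_mulVec_mulVec hν, reflMatrix_mulVec, reflMatrix_mulVec, sub_right_inj, mul_smul,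
      mul_smul] at h
    exact smul_right_injective _ (two_ne_zero (α := ℝ)) h
  have hcoord : ∀ i : Fin n, v i.succ = 0 ∧ v 0 = 0 := by
    intro i
    have hl : ∀ (a b : ℝ) (x : Mink n), lorentz x (a • Pi.single 0 1 + b • Pi.single i.succ 1) =
        -(a * x 0) + b * x i.succ := fun a b x => by
      rw [lorentz_add_right, lorentz_smul_right, lorentz_smul_right]
      simp [lorentz, Pi.single_apply, Fin.succ_inj, (Fin.succ_ne_zero _).symm]
    -- Since `-(3/4)² + (5/4)² = 1`, the second vector is again unit space-like. Together the two
    -- span the plane of coordinates `0` and `i.succ`.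
    have h := key ((0 : ℝ) • Pi.single 0 1 + (1 : ℝ) • Pi.single i.succ 1)
      ((3 / 4 : ℝ) • Pi.single 0 1 + (5 / 4 : ℝ) • Pi.single i.succ 1)
      (by rw [hl]; simp) (by rw [hl]; simp; norm_num)
    have h0 := congrFun h 0
    have h1 := congrFun h i.succ
    simp only [hl] at h0 h1
    simp at h0 h1
    rw [h0] at h1
    have : v i.succ = 0 := by linarith
    refine ⟨this, ?_⟩
    rw [this] at h0; linarith
  funext i
  refine Fin.cases ?_ (fun i => (hcoord i).1) i
  exact (hcoord ⟨0, hn⟩).2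

/-- Fixing `v` is a system of polynomial equations in the matrix entries, so it passes from `S` to
`SO⁺(n,1)`. -/
theorem IsZariskiDense.eq_zero (hn : 1 ≤ n) {S : Set (OPlus n)} (hS : IsZariskiDense S)
    {v : Mink n} (hv : ∀ g ∈ S, isom g v = v) : v = 0 := by
  refine eq_zero_of_forall_mem_SOPlus hn fun g hg => funext fun i => ?_
  have heval : ∀ g : OPlus n, MvPolynomial.eval (fun ij => g.val.val ij.1 ij.2)
      (∑ j, MvPolynomial.X (i, j) * MvPolynomial.C (v j) - MvPolynomial.C (v i)) =
      isom g v i - v i := fun g => by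
    simp [isom_apply, Matrix.mulVec, dotProduct]
  have := hS _ (fun g hg => by rw [heval, hv g hg, sub_self]) g hg
  rwa [heval, sub_eq_zero] at this

end Reflection

/-! ### The deformation class of a solution -/

section Cocycle

variable {n : ℕ} {Γ : Subgroup (OPlus n)} {Δ B : Set (Mfd Γ)}

/-- `c` measures the failure of `f` to be `Γ`-equivariant off the hypersurface. -/
def IsDeviation (Δ : Set (Mfd Γ)) (f : Mink n → Mink n) (c : Γ → Mink n) : Prop :=
  ∀ (γ : Γ), ∀ x ∈ futureCone n, x ∉ coneOver (upstairs Γ Δ) →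
    isom (γ : OPlus n) (f ((isom (γ : OPlus n)).symm x)) = f x + c γ

variable {w : Option (ConnectedComponents ↥(Δ \ B)) → ℝ} {f : Mink n → Mink n} {c : Γ → Mink n}

/-- Hypersurface and labels are `Γ`-invariant, so the translate of `f` by `γ` solves the same jump
problem as `f`; uniqueness up to a constant applies. -/
theorem exists_isDeviation (h : IsBranchedHypersurface Γ Δ B)
    (hf : h.cone.SolvesOn w f (futureCone n)) : ∃ c, IsDeviation Δ f c := by
  have hall : ∀ γ : Γ, ∃ c, ∀ x ∈ futureCone n, x ∉ coneOver (upstairs Γ Δ) →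
      isom (γ : OPlus n) (f ((isom (γ : OPlus n)).symm x)) = f x + c := by
    intro γ
    refine BranchedCone.SolvesOn.exists_eq_add_const (T := h.cone) (w := w)
      isOpen_futureCone convex_futureCone subset_rfl (fun p hp hL => ?_) hf
    set A := isom (γ : OPlus n) with hA
    have hp' : A.symm p ∈ futureCone n := by
      rw [← isom_mem_futureCone_iff (γ : OPlus n), ← hA, A.apply_symm_apply]; exact hp
    have hL' : A.symm p ∉ h.cone.L := by
      intro h'
      have := (isom_mem_coneOver_upstairs_iff γ.2 B (A.symm p)).2 h'
      rw [← hA, A.apply_symm_apply] at this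
      exact hL this
    have := (hf _ hp' hL').map (A := A) (s := 1) (fun x y => by rw [hA, lorentz_isom]; ring)
      one_pos (isom_mem_coneOver_upstairs_iff γ.2 Δ)
      (congrArg w (componentLabel_isom γ.2 (Δ \ B) _))
    simp only [inv_one, one_smul, A.apply_symm_apply] at this
    exact this
  choose c hc using hall
  exact ⟨c, hc⟩

theorem IsDeviation.mem_cocycles₁ (h : IsBranchedHypersurface Γ Δ B) (hc : IsDeviation Δ f c) :
    c ∈ groupCohomology.cocycles₁ (Rep.of (stdRep Γ)) := by
  rw [groupCohomology.mem_cocycles₁_iff]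
  intro γ γ'
  obtain ⟨x, hx, hxD⟩ : ∃ x ∈ futureCone n, x ∉ coneOver (upstairs Γ Δ) := by
    have hy := val_mem_futureCone (hypBase n)
    have := h.cone.neBot hy
    have hC : ∀ᶠ x in 𝓝[h.cone.Dᶜ] (hypBase n).val, x ∈ futureCone n :=
      nhdsWithin_le_nhds (isOpen_futureCone.mem_nhds hy)
    obtain ⟨x, h1, h2⟩ := (hC.and self_mem_nhdsWithin).exists
    exact ⟨x, h1, h2⟩
  have hsymm : ∀ y, (isom ((γ * γ' : Γ) : OPlus n)).symm y =
      (isom (γ' : OPlus n)).symm ((isom (γ : OPlus n)).symm y) := fun y => by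
    rw [ContinuousLinearEquiv.symm_apply_eq, Subgroup.coe_mul, isom_mul,
      ContinuousLinearEquiv.apply_symm_apply, ContinuousLinearEquiv.apply_symm_apply]
  have hx' : (isom (γ : OPlus n)).symm x ∈ futureCone n := by
    rw [← isom_mem_futureCone_iff (γ : OPlus n), ContinuousLinearEquiv.apply_symm_apply]
    exact hx
  have hxD' : (isom (γ : OPlus n)).symm x ∉ coneOver (upstairs Γ Δ) := by
    rw [← isom_mem_coneOver_upstairs_iff γ.2, ContinuousLinearEquiv.apply_symm_apply]
    exact hxD
  have h1 := hc (γ * γ') x hx hxD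
  rw [hsymm, Subgroup.coe_mul, isom_mul, hc γ' _ hx' hxD', map_add, hc γ x hx hxD, add_assoc,
    add_right_inj] at h1
  exact h1.symm.trans (add_comm _ _)

theorem IsDeviation.sum {ι : Type*} (s : Finset ι) (a : ι → ℝ) {f : ι → Mink n → Mink n}
    {c : ι → Γ → Mink n} (hc : ∀ i, IsDeviation Δ (f i) (c i)) :
    IsDeviation Δ (∑ i ∈ s, a i • f i) (∑ i ∈ s, a i • c i) := by
  intro γ x hx hxD
  simp only [Finset.sum_apply, Pi.smul_apply, map_sum, map_smul, ← Finset.sum_add_distrib,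
    ← smul_add, hc _ γ x hx hxD]

/-- If the deviation is a coboundary and the stabilizers of the cells are Zariski dense, then the
weights vanish. -/
theorem IsDeviation.weight_eq_zero (hn : 1 ≤ n) (h : IsBranchedHypersurface Γ Δ B)
    (hcells : ∀ δ ∈ cells Γ Δ, IsZariskiDense (setwiseFix Γ δ))
    (hf : h.cone.SolvesOn w f (futureCone n)) (hc : IsDeviation Δ f c) {v : Mink n}
    (hv : ∀ γ : Γ, c γ = isom (γ : OPlus n) v - v) (q : ConnectedComponents ↥(Δ \ B)) :
    w (some q) = 0 := by
  have hloc : ∀ p ∈ futureCone n, p ∉ coneOver (upstairs Γ Δ) →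
      ∃ c, ∀ᶠ x in 𝓝 p, f x = c := by
    intro p hp hD
    obtain ⟨c, hc⟩ := hf p hp (fun hL => hD (h.cone.locus_subset hL)) 0 (Or.inl ⟨hD, rfl⟩)
    refine ⟨c, ?_⟩
    filter_upwards [eventually_nhdsWithin_iff.1 hc, h.cone.eventually_notMem p hp hD]
      with x hx hxD
    simpa using hx hxD
  have hconst : ∀ {X : Type} [TopologicalSpace X] (F : X → Mink n) (_ : Continuous F) (S : Set X),
      IsPreconnected S → (∀ x ∈ S, F x ∈ futureCone n ∧ F x ∉ coneOver (upstairs Γ Δ)) →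
      ∀ x ∈ S, ∀ y ∈ S, f (F x) = f (F y) := by
    intro X _ F hF S hS hSD x hx y hy
    obtain ⟨k, hk⟩ := IsPreconnected.exists_eq_of_eventually_eq (D := ∅) (h := fun x => f (F x))
      hS (fun p _ => by rw [Set.compl_empty, nhdsWithin_univ]; infer_instance) (fun p hp => by
        rw [Set.compl_empty, nhdsWithin_univ]
        obtain ⟨k, hk⟩ := hloc _ (hSD p hp).1 (hSD p hp).2
        exact ⟨k, hF.continuousAt.eventually hk⟩)
    rw [hk x hx (Set.notMem_empty x), hk y hy (Set.notMem_empty y)]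
  have hequiv : ∀ γ : Γ, ∀ x ∈ futureCone n, x ∉ coneOver (upstairs Γ Δ) →
      isom (γ : OPlus n) (f ((isom (γ : OPlus n)).symm x) - v) = f x - v := by
    intro γ x hx hxD
    rw [map_sub, hc γ x hx hxD, hv]; abel
  have hhyp : ∀ x : Hyp n, x ∉ upstairs Γ Δ → f x.val = v := by
    intro x hx
    rw [← sub_eq_zero]
    refine (hcells _ ⟨x, hx, rfl⟩).eq_zero hn ?_
    rintro γ ⟨hγ, hfix⟩
    set δ := connectedComponentIn (upstairs Γ Δ)ᶜ x with hδ
    have hxδ : x ∈ δ := mem_connectedComponentIn hx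
    obtain ⟨y, hy, hyx⟩ : x ∈ (fun x : Hyp n => γ • x) '' δ := by rw [hfix]; exact hxδ
    have hmem : ∀ z ∈ δ, z.val ∈ futureCone n ∧ z.val ∉ coneOver (upstairs Γ Δ) := fun z hz =>
      ⟨val_mem_futureCone z, by
        rw [val_mem_coneOver_iff]; exact connectedComponentIn_subset _ _ hz⟩
    -- The points `x` and `γ⁻¹x` lie in the same cell, so `f` agrees there, and equivariance of `f -
    -- v` says that `γ` fixes `f x - v`.
    have hxy := hconst Subtype.val continuous_subtype_val δ isPreconnected_connectedComponentIn
      hmem x hxδ y hy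
    have h1 := hequiv ⟨γ, hγ⟩ x.val (hmem x hxδ).1 (hmem x hxδ).2
    have h2 : (isom γ).symm x.val = y.val := by
      rw [ContinuousLinearEquiv.symm_apply_eq, isom_val]
      exact congrArg Subtype.val hyx.symm
    rw [h2, ← hxy] at h1
    exact h1
  have hall : ∀ x ∈ futureCone n, x ∉ coneOver (upstairs Γ Δ) → f x = v := by
    intro x hx hxD
    obtain ⟨s, hs, hxs⟩ := exists_eq_smul_radial hx
    rw [← hhyp (radial x) fun h' => hxD ⟨hx, h'⟩]
    have := hconst (fun t : ℝ => t • (radial x).val) (by fun_prop) (Set.Ioi 0)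
      (convex_Ioi 0).isPreconnected (fun t ht =>
        ⟨smul_mem_futureCone ht (val_mem_futureCone _), by
          rw [smul_mem_coneOver_iff ht, val_mem_coneOver_iff]
          exact fun h' => hxD ⟨hx, h'⟩⟩) s hs 1 (Set.mem_Ioi.2 one_pos)
    simpa [← hxs] using this
  obtain ⟨⟨m, hm⟩, rfl⟩ := ConnectedComponents.surjective_coe q
  obtain ⟨y, rfl⟩ := Quotient.exists_rep m
  have hyC := val_mem_futureCone y
  have hyD : y.val ∈ coneOver (upstairs Γ Δ) := (val_mem_coneOver_iff y).2 hm.1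
  have hyL : y.val ∉ coneOver (upstairs Γ B) := fun h' => hm.2 ((val_mem_coneOver_iff y).1 h')
  obtain ⟨ν, hν, -⟩ := exists_isUnitNormal_coneOver h hyC hyD hyL
  obtain ⟨k, hk⟩ := hf _ hyC hyL ν (Or.inr hν)
  have hlabel : h.cone.label y.val = some (ConnectedComponents.mk ⟨_, hm⟩) := by
    have hm' : toMfd Γ y.val ∈ Δ \ B := by rw [toMfd, radial_val_self]; exact hm
    refine (componentLabel_of_mem hyC hm').trans ?_
    congr 3
    rw [toMfd, radial_val_self]
  simp only [hlabel] at hk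
  set W := w (some (ConnectedComponents.mk (⟨_, hm⟩ : ↥(Δ \ B)))) with hW
  -- Since `f` equals `v` on both sides of the hypersurface, comparing one point on each side shows
  -- that the jump `2Wν` is zero.
  have hev : ∀ᶠ x in 𝓝 y.val, lorentz x ν ≠ 0 → v = k + W • Real.sign (lorentz x ν) • ν := by
    filter_upwards [eventually_nhdsWithin_iff.1 hk, hν.eventually,
      isOpen_futureCone.mem_nhds hyC] with x h1 h2 h3 hne
    have hxD : x ∉ coneOver (upstairs Γ Δ) := fun h' => hne (h2.1 h')
    rw [← h1 hxD, hall x h3 hxD]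
  obtain ⟨t, ht, h1⟩ := exists_pos_add_smul hev ν
  obtain ⟨s, hs, h2⟩ := exists_pos_add_smul hev (-ν)
  have e1 : lorentz (y.val + t • ν) ν = t := by
    rw [lorentz_add_left, lorentz_smul_left, hν.mem, hν.unit]; ring
  have e2 : lorentz (y.val + s • -ν) ν = -s := by
    rw [lorentz_add_left, lorentz_smul_left, lorentz_neg_left, hν.mem, hν.unit]; ring
  rw [e1, Real.sign_of_pos ht] at h1
  rw [e2, Real.sign_of_neg (neg_lt_zero.2 hs)] at h2
  have h3 := (h1 ht.ne').symm.trans (h2 (neg_ne_zero.2 hs.ne'))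
  have h4 := congrArg (fun x => lorentz x ν) h3
  simp only [lorentz_add_left, lorentz_smul_left, hν.unit] at h4
  linarith

end Cocycle

/-- The kernel of a linear map on `ℝᵏ` has dimension at least `k` minus the dimension of the
target. -/
theorem le_finrank_ker_add {k : ℕ} {V : Type*} [AddCommGroup V] [Module ℝ V] [FiniteDimensional ℝ V]
    (S : (Fin k → ℝ) →ₗ[ℝ] V) : k ≤ Module.finrank ℝ (LinearMap.ker S) + Module.finrank ℝ V := by
  have h1 := S.finrank_range_add_finrank_ker
  have h2 := Submodule.finrank_le (LinearMap.range S)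
  rw [Module.finrank_fin_fun] at h1
  omega

/-! ### Independence of the cohomology classes -/

section Classes

variable {n : ℕ} {Γ : Subgroup (OPlus n)} {Δ B : Set (Mfd Γ)}

/-- A family of solvable weights whose members are linearly independent on the smooth components
gives linearly independent cohomology classes. -/
theorem card_le_rank_H1 (hn : 1 ≤ n) (h : IsBranchedHypersurface Γ Δ B)
    (hcells : ∀ δ ∈ cells Γ Δ, IsZariskiDense (setwiseFix Γ δ)) {d : ℕ}
    (w : Fin d → Option (ConnectedComponents ↥(Δ \ B)) → ℝ)
    (hw : LinearIndependent ℝ fun i q => w i (some q))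
    (hsol : ∀ i, ∃ f, h.cone.SolvesOn (w i) f (futureCone n)) :
    (d : Cardinal) ≤ Module.rank ℝ (H1 Γ) := by
  choose f hf using hsol
  choose c hc using fun i => exists_isDeviation h (hf i)
  let z : Fin d → groupCohomology.cocycles₁ (Rep.of (stdRep Γ)) := fun i =>
    ⟨c i, (hc i).mem_cocycles₁ h⟩
  have hli : LinearIndependent ℝ fun i => (groupCohomology.H1π (Rep.of (stdRep Γ))).hom (z i) := by
    rw [Fintype.linearIndependent_iff]
    intro a ha
    simp only [← map_smul, ← map_sum] at ha
    obtain ⟨v, hv⟩ := (groupCohomology.H1π_eq_zero_iff _).1 ha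
    refine Fintype.linearIndependent_iff.1 hw a (funext fun q => ?_)
    -- The jump problem is linear in the weights, so a relation among the classes turns into one
    -- solution whose deviation is a coboundary.
    have hsum : h.cone.SolvesOn (∑ i, a i • w i) (∑ i, a i • f i) (futureCone n) := by
      intro p hp hL
      have := HasJump.sum Finset.univ fun i _ => (hf i p hp hL).const_smul (a i)
      convert this using 1
      funext x
      simp
    have hv' : ∀ γ : Γ, (∑ i, a i • c i) γ = isom (γ : OPlus n) v - v := by
      intro γ
      have h1 := congrFun hv γ
      have h2 : ((∑ i, a i • z i : groupCohomology.cocycles₁ (Rep.of (stdRep Γ))) :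
          Γ → Mink n) = ∑ i, a i • c i := by
        change (groupCohomology.cocycles₁ (Rep.of (stdRep Γ))).subtype (∑ i, a i • z i) = _
        rw [map_sum]
        rfl
      rw [← h2]
      exact h1.symm
    have := (IsDeviation.sum Finset.univ a hc).weight_eq_zero hn h hcells hsum hv' q
    simpa using this
  have := hli.cardinal_lift_le_rank
  simpa using this

end Classes

end BranchedBending

end

/-! ### The dimension count -/

theorem theorem1p1 (n : ℕ) (hn : 2 ≤ n)
    (Γ : Subgroup (BranchedBending.OPlus n))
    (hdiscrete : DiscreteTopology Γ)
    (htorsionFree : ∀ γ : Γ, IsOfFinOrder γ → γ = 1)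
    (Δ B : Set (BranchedBending.Mfd Γ))
    (hΔ : BranchedBending.IsBranchedHypersurface Γ Δ B)
    (hcells : ∀ δ ∈ BranchedBending.cells Γ Δ,
      BranchedBending.IsZariskiDense (BranchedBending.setwiseFix Γ δ)) :
    BranchedBending.numComponents (Δ \ B) ≤
      Cardinal.toENat (Module.rank ℝ (BranchedBending.H1 Γ)) +
        2 * BranchedBending.numComponents B := by
  classical
  rcases finite_or_infinite (ConnectedComponents B) with hfin | hinf
  swap
  · have : BranchedBending.numComponents B = ⊤ := ENat.card_eq_top_of_infinite
    rw [this, ENat.mul_top (by norm_num), add_top]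
    exact le_top
  have := Fintype.ofFinite (ConnectedComponents B)
  obtain ⟨S, hS⟩ := BranchedBending.exists_conditions hΔ
  -- There may be infinitely many smooth components, so the bound is tested on each finite `k` with
  -- `k` chosen components.
  refine ENat.forall_natCast_le_iff_le.1 fun k hk => ?_
  rw [BranchedBending.numComponents, ENat.card, Cardinal.natCast_le_toENat,
    ← Cardinal.mk_fin, Cardinal.le_def] at hk
  obtain ⟨e⟩ := hk
  -- Weights on the chosen components are extended by zero. Only finitely many unknowns then meet
  -- the finitely many conditions in `R`.
  let ι : (Fin k → ℝ) →ₗ[ℝ] (Option (ConnectedComponents ↥(Δ \ B)) → ℝ) :=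
    LinearMap.pi fun o => ∑ i, if o = some (e i) then LinearMap.proj i else 0
  have hι : ∀ u i, ι u (some (e i)) = u i := fun u i => by
    simp [ι]
  let R := LinearMap.pi fun b => (S b).comp ι
  have hdim := BranchedBending.le_finrank_ker_add R
  let b := Module.finBasis ℝ (LinearMap.ker R)
  have hrank := BranchedBending.card_le_rank_H1 (by omega) hΔ hcells
    (fun i => ι (b i)) (by
      -- Reading the weights back on the chosen components recovers the kernel basis, which proves
      -- independence.
      let ρ : (ConnectedComponents ↥(Δ \ B) → ℝ) →ₗ[ℝ] (Fin k → ℝ) := LinearMap.funLeft ℝ ℝ e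
      refine LinearIndependent.of_comp ρ ?_
      have : (ρ ∘ fun i q => ι (b i) (some q)) = (LinearMap.ker R).subtype ∘ b := by
        funext i j
        exact hι _ j
      rw [this]
      exact b.linearIndependent.map' _ (Submodule.ker_subtype _))
    (fun i => hS _ fun c => congrFun (LinearMap.mem_ker.1 (b i).2) c)
  have hd : Module.finrank ℝ (ConnectedComponents B → Fin 2 → ℝ) =
      2 * Fintype.card (ConnectedComponents B) := by
    simp [Module.finrank_pi_fintype, mul_comm]
  rw [hd] at hdim
  have hB : BranchedBending.numComponents B = (Fintype.card (ConnectedComponents B) : ℕ∞) :=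
    ENat.card_eq_coe_fintype_card
  calc (k : ℕ∞) ≤ ((Module.finrank ℝ (LinearMap.ker R) +
        2 * Fintype.card (ConnectedComponents B) : ℕ) : ℕ∞) := by exact_mod_cast hdim
    _ = (Module.finrank ℝ (LinearMap.ker R) : ℕ∞) + 2 * BranchedBending.numComponents B := by
        rw [hB]; push_cast; rfl
    _ ≤ _ := by gcongr; exact Cardinal.natCast_le_toENat.2 hrank
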